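/- Let $(M,\rho,\mu)$ be an unbounded metric space with a Borel measure $\mu$ such that $0<\mu(M)<\infty$, and assume: (LD) for every $b>0$ there is $D_b<\infty$ with $\mu(2B)\le D_b\,\mu(B)$ for every ball $B$ of radius at most $b$; (AM) there are $R_0\in[0,\infty)$ and $\beta\in(1/2,1)$ such that for all $x,y\in M$ with $\rho(x,y)>R_0$ there is $z\in M$ with $\rho(x,z)<\beta\,\rho(x,y)$ and $\rho(y,z)<\beta\,\rho(x,y)$; (I$^c$) there are a ball $B_0$ and constants $\kappa_0,C_0>0$ such that, for every open set $A\subset M\setminus\overline{B_0}$ and every $\kappa\in(0,\kappa_0]$, $\mu(\{x\in A:\rho(x,A^c)\le\kappa\})\ge C_0\,\kappa\,\mu(A)$. Let $r\in(1,\infty)$, $1/r+1/r'=1$. A $(1,r)$-standard atom is a function $a\in L^1(\mu)$ supported in a ball $B$ with $\int_B a\,d\mu=0$ and $\big(\mu(B)^{-1}\int_B|a|^r\,d\mu\big)^{1/r}\le\mu(B)^{-1}$; the exceptional atom is the constant function $1/\mu(M)$; a $(1,r)$-atom is either of these. Fix a scale $b>R_0/(1-\beta)$. The space $H^{1,r}(\mu)=H^{1,r}_b(\mu)$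 consists of all $g\in L^1(\mu)$ of the form $g=\sum_k\lambda_k a_k$, where $\sum_k|\lambda_k|<\infty$ and each $a_k$ is either the exceptional atom or a $(1,r)$-standard atom supported in a ball of radius at most $b$; its norm is the infimum of $\sum_k|\lambda_k|$ over all such decompositions. $H^{1,r}_{\mathrm{fin}}(\mu)$ is its subspace of finite linear combinations of $(1,r)$-atoms. The space $BMO^{r'}(\mu)=BMO^{r'}_b(\mu)$ consists of all $f\in L^1(\mu)$ for which $N(f)=\sup_B\big(\mu(B)^{-1}\int_B|f-f_B|^{r'}\,d\mu\big)^{1/r'}$ is finite, where the supremum is over all balls $B$ of radius at most $b$ and $f_B$ is the mean of $f$ over $B$; its norm is $\|f\|_{BMO^{r'}(\mu)}=\|f\|_{L^1(\mu)}+N(f)$. Then: (i) for every $f\in BMO^{r'}(\mu)$ the functional $\ell(g)=\int_M f\,g\,d\mu$, defined by a convergent integral for $g\in H^{1,r}_{\mathrm{fin}}(\mu)$, extends to a bounded linear functional on $H^{1,r}(\mu)$ with norm at most $\max\{1,1/\mu(M)\}\,\|f\|_{BMO^{r'}(\mu)}$ (so at most $\|f\|_{BMO^{r'}(\mu)}$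 when $\mu(M)\ge1$); (ii) there is a constant $C$ such that for every bounded linear functional $\ell$ on $H^{1,r}(\mu)$ there is $f^\ell\in BMO^{r'}(\mu)$ (in particular $f^\ell\in L^1(\mu)$) with $\|f^\ell\|_{BMO^{r'}(\mu)}\le C\,\|\ell\|_{H^{1,r}(\mu)^*}$ and $\ell(g)=\int_M f^\ell g\,d\mu$, the integral being convergent, for all $g\in H^{1,r}_{\mathrm{fin}}(\mu)$. -/

import Mathlib

open MeasureTheory Set Metric
open scoped ENNReal NNReal

noncomputable section

/-! ### Geometric assumptions -/

/-- Local doubling property: for each scale `b > 0` there is a finite constant `D` such that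
`μ (2B) ≤ D μ (B)` for every (open) ball `B` of radius at most `b`. -/
def LocallyDoubling {M : Type*} [MetricSpace M] [MeasurableSpace M] (μ : Measure M) : Prop :=
  ∀ b : ℝ, 0 < b → ∃ D : ℝ≥0, ∀ (x : M) (ρ : ℝ), 0 < ρ → ρ ≤ b →
    μ (ball x (2 * ρ)) ≤ D * μ (ball x ρ)

/-- Approximate midpoint property with constants `R₀ ∈ [0, ∞)` and `β ∈ (1/2, 1)`. -/
def ApproxMidpoint (M : Type*) [MetricSpace M] (R₀ β : ℝ) : Prop :=
  0 ≤ R₀ ∧ 1 / 2 < β ∧ β < 1 ∧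
    ∀ x y : M, R₀ < dist x y → ∃ z : M, dist x z < β * dist x y ∧ dist y z < β * dist x y

/-- The inner collar `A_κ = {x ∈ A : ρ(x, Aᶜ) ≤ κ}`. -/
def innerCollar {M : Type*} [MetricSpace M] (A : Set M) (κ : ℝ) : Set M :=
  {x ∈ A | infEDist x Aᶜ ≤ ENNReal.ofReal κ}

/-- Complementary isoperimetric property. -/
def ComplIsoperimetric {M : Type*} [MetricSpace M] [MeasurableSpace M] (μ : Measure M) : Prop :=
  ∃ (x₀ : M) (R κ₀ C : ℝ), 0 < R ∧ 0 < κ₀ ∧ 0 < C ∧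
    ∀ A : Set M, IsOpen A → A ⊆ (closure (ball x₀ R))ᶜ → ∀ κ : ℝ, 0 < κ → κ ≤ κ₀ →
      ENNReal.ofReal (C * κ) * μ A ≤ μ (innerCollar A κ)

/-! ### Atoms -/

section Atoms

variable {M : Type*} [MetricSpace M] [MeasurableSpace M]

/-- `a` is a `(1, r)`-standard atom (`1 < r < ∞`) supported in the ball `B` with centre `x` and
radius `ρ`:  `((1 / μ B) ∫_B |a| ^ r) ^ (1 / r) ≤ 1 / μ B`  and  `∫_B a = 0`. -/
def IsStandardAtomOn (μ : Measure M) (r : ℝ) (x : M) (ρ : ℝ) (a : Lp ℂ 1 μ) : Prop :=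
  (∀ᵐ y ∂μ, y ∉ ball x ρ → a y = 0) ∧
  ((μ (ball x ρ))⁻¹ * ∫⁻ y in ball x ρ, ‖a y‖ₑ ^ r ∂μ) ^ (1 / r) ≤ (μ (ball x ρ))⁻¹ ∧
  ∫ y in ball x ρ, a y ∂μ = 0

/-- The exceptional atom: the constant function `1 / μ(M)`. -/
def IsExceptionalAtom (μ : Measure M) (a : Lp ℂ 1 μ) : Prop :=
  a =ᵐ[μ] fun _ => (((μ.real univ)⁻¹ : ℝ) : ℂ)

/-- The atoms at scale `b`: the `(1, r)`-standard atoms supported in balls of radius at most `b`,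
and the exceptional atom. -/
def IsAtomAtScale (μ : Measure M) (r b : ℝ) (a : Lp ℂ 1 μ) : Prop :=
  (∃ (x : M) (ρ : ℝ), 0 < ρ ∧ ρ ≤ b ∧ IsStandardAtomOn μ r x ρ a) ∨ IsExceptionalAtom μ a

/-- Finite linear combinations of `(1, r)`-atoms (standard atoms supported in arbitrary balls, and
the exceptional atom). -/
def finiteAtomic (μ : Measure M) (r : ℝ) : Submodule ℂ (Lp ℂ 1 μ) :=
  Submodule.span ℂ
    {a | (∃ (x : M) (ρ : ℝ), 0 < ρ ∧ IsStandardAtomOn μ r x ρ a) ∨ IsExceptionalAtom μ a}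

/-! ### The atomic Hardy space -/

/-- `g = ∑ c k • a k` in `L¹`, with `a k` atoms at scale `b` and `∑ |c k| < ∞`. -/
def IsAtomicDecomposition (μ : Measure M) (r b : ℝ) (g : Lp ℂ 1 μ)
    (c : ℕ → ℂ) (a : ℕ → Lp ℂ 1 μ) : Prop :=
  (∀ k, IsAtomAtScale μ r b (a k)) ∧ Summable (fun k => ‖c k‖) ∧ HasSum (fun k => c k • a k) g

/-- The numbers `∑ |c k|` over all atomic decompositions of `g` at scale `b`. -/
def atomicCosts (μ : Measure M) (r b : ℝ) (g : Lp ℂ 1 μ) : Set ℝ :=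
  {s | ∃ c a, IsAtomicDecomposition μ r b g c a ∧ s = ∑' k, ‖c k‖}

theorem atomicCosts_bddBelow (μ : Measure M) (r b : ℝ) (g : Lp ℂ 1 μ) :
    BddBelow (atomicCosts μ r b g) :=
  ⟨0, by rintro s ⟨c, a, -, rfl⟩; exact tsum_nonneg fun k => norm_nonneg _⟩

theorem atomicCosts_zero (μ : Measure M) [IsFiniteMeasure μ] (r b : ℝ) :
    (0 : ℝ) ∈ atomicCosts μ r b (0 : Lp ℂ 1 μ) := by
  have h : MemLp (fun _ : M => (((μ.real univ)⁻¹ : ℝ) : ℂ)) 1 μ := memLp_const _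
  exact ⟨fun _ => 0, fun _ => h.toLp _, ⟨fun _ => Or.inr h.coeFn_toLp,
    by simp [summable_zero], by simp [hasSum_zero]⟩, by simp⟩

theorem atomicCosts_smul {μ : Measure M} {r b : ℝ} {g : Lp ℂ 1 μ} {s : ℝ} (z : ℂ)
    (hs : s ∈ atomicCosts μ r b g) : ‖z‖ * s ∈ atomicCosts μ r b (z • g) := by
  obtain ⟨c, a, ⟨h1, h2, h3⟩, rfl⟩ := hs
  refine ⟨fun k => z * c k, a, ⟨h1, ?_, ?_⟩, ?_⟩
  · simpa [norm_mul] using h2.mul_left ‖z‖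
  · simpa [mul_smul] using h3.const_smul z
  · simp [tsum_mul_left]

theorem atomicCosts_add {μ : Measure M} {r b : ℝ} {g h : Lp ℂ 1 μ} {s t : ℝ}
    (hs : s ∈ atomicCosts μ r b g) (ht : t ∈ atomicCosts μ r b h) :
    s + t ∈ atomicCosts μ r b (g + h) := by
  obtain ⟨c, a, ⟨h1, h2, h3⟩, rfl⟩ := hs
  obtain ⟨c', a', ⟨h1', h2', h3'⟩, rfl⟩ := ht
  have key : HasSum (fun k => ‖(if Even k then c (k / 2) else c' (k / 2))‖)
      (∑' k, ‖c k‖ + ∑' k, ‖c' k‖) := by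
    refine HasSum.even_add_odd ?_ ?_
    · simpa using h2.hasSum
    · simpa [Nat.mul_add_div] using h2'.hasSum
  refine ⟨fun k => if Even k then c (k / 2) else c' (k / 2),
    fun k => if Even k then a (k / 2) else a' (k / 2), ⟨fun k => ?_, key.summable, ?_⟩,
    key.tsum_eq.symm⟩
  · by_cases hk : Even k
    · simpa [hk] using h1 _
    · simpa [hk] using h1' _
  · refine HasSum.even_add_odd ?_ ?_
    · simpa using h3
    · simpa [Nat.mul_add_div] using h3'

/-- The functions of the Hardy space `H_b^{1,r}(μ)`, as a subspace of `L¹(μ)`. -/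
def hardySubmodule (μ : Measure M) [IsFiniteMeasure μ] (r b : ℝ) : Submodule ℂ (Lp ℂ 1 μ) where
  carrier := {g | (atomicCosts μ r b g).Nonempty}
  zero_mem' := ⟨0, atomicCosts_zero μ r b⟩
  add_mem' := fun ⟨_, hs⟩ ⟨_, ht⟩ => ⟨_, atomicCosts_add hs ht⟩
  smul_mem' := fun z _ ⟨_, hs⟩ => ⟨_, atomicCosts_smul z hs⟩

/-- The Hardy space `H_b^{1,r}(μ)`. It is a type synonym of the subspace of `L¹(μ)`, because it
carries the atomic norm instead of the `L¹` norm. -/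
def HardySpace (μ : Measure M) [IsFiniteMeasure μ] (r b : ℝ) : Type _ := hardySubmodule μ r b

namespace HardySpace

variable (μ : Measure M) [IsFiniteMeasure μ] (r b : ℝ)

instance : AddCommGroup (HardySpace μ r b) :=
  inferInstanceAs (AddCommGroup (hardySubmodule μ r b))

instance : Module ℂ (HardySpace μ r b) :=
  inferInstanceAs (Module ℂ (hardySubmodule μ r b))

/-- The inclusion of `H_b^{1,r}(μ)` into `L¹(μ)`. -/
def toL1 : HardySpace μ r b →ₗ[ℂ] Lp ℂ 1 μ := (hardySubmodule μ r b).subtype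

/-- The atomic norm: the infimum of `∑ |c k|` over all atomic decompositions. -/
instance : Norm (HardySpace μ r b) := ⟨fun g => sInf (atomicCosts μ r b (toL1 μ r b g))⟩

theorem norm_def (g : HardySpace μ r b) : ‖g‖ = sInf (atomicCosts μ r b (toL1 μ r b g)) := rfl

theorem costs_nonempty (g : HardySpace μ r b) : (atomicCosts μ r b (toL1 μ r b g)).Nonempty :=
  g.2

theorem hardy_norm_nonneg (g : HardySpace μ r b) : 0 ≤ ‖g‖ := by
  refine Real.sInf_nonneg ?_
  rintro s ⟨c, a, -, rfl⟩
  exact tsum_nonneg fun k => norm_nonneg _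

theorem hardy_norm_smul_le (z : ℂ) (g : HardySpace μ r b) : ‖z • g‖ ≤ ‖z‖ * ‖g‖ := by
  have := (costs_nonempty μ r b g).to_subtype
  rw [norm_def μ r b g, sInf_eq_iInf', Real.mul_iInf_of_nonneg (norm_nonneg z)]
  refine le_ciInf fun s => ?_
  rw [norm_def, map_smul]
  exact csInf_le (atomicCosts_bddBelow μ r b _) (atomicCosts_smul z s.2)

theorem core : SeminormedSpace.Core ℂ (HardySpace μ r b) where
  norm_nonneg := hardy_norm_nonneg μ r b
  norm_smul := fun z g => by
    refine le_antisymm (hardy_norm_smul_le μ r b z g) ?_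
    rcases eq_or_ne z 0 with rfl | hz
    · simpa using hardy_norm_nonneg μ r b _
    · have h := hardy_norm_smul_le μ r b z⁻¹ (z • g)
      rw [inv_smul_smul₀ hz, norm_inv] at h
      have hz' : 0 < ‖z‖ := norm_pos_iff.mpr hz
      calc ‖z‖ * ‖g‖ ≤ ‖z‖ * (‖z‖⁻¹ * ‖z • g‖) := by gcongr
        _ = ‖z • g‖ := by field_simp
  norm_triangle := fun g h => by
    refine le_of_forall_pos_lt_add fun ε hε => ?_
    obtain ⟨s, hs, hs'⟩ := exists_lt_of_csInf_lt (costs_nonempty μ r b g)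
      (show sInf (atomicCosts μ r b (toL1 μ r b g)) < ‖g‖ + ε / 2 by
        rw [← norm_def]; linarith)
    obtain ⟨t, ht, ht'⟩ := exists_lt_of_csInf_lt (costs_nonempty μ r b h)
      (show sInf (atomicCosts μ r b (toL1 μ r b h)) < ‖h‖ + ε / 2 by
        rw [← norm_def]; linarith)
    have : ‖g + h‖ ≤ s + t := by
      rw [norm_def, map_add]
      exact csInf_le (atomicCosts_bddBelow μ r b _) (atomicCosts_add hs ht)
    linarith

instance : SeminormedAddCommGroup (HardySpace μ r b) := SeminormedAddCommGroup.ofCore (core μ r b)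

instance : NormedSpace ℂ (HardySpace μ r b) where
  norm_smul_le := hardy_norm_smul_le μ r b

end HardySpace

/-! ### Functions of bounded mean oscillation -/

/-- `N_b^q(f)`, the supremum over the balls `B` of radius at most `b` of
`((1 / μ B) ∫_B |f - f_B| ^ q) ^ (1 / q)`. -/
def meanOscillation (μ : Measure M) (q b : ℝ) (f : M → ℂ) : ℝ≥0∞ :=
  ⨆ (x : M) (ρ : ℝ) (_ : 0 < ρ) (_ : ρ ≤ b),
    ((μ (ball x ρ))⁻¹ *
      ∫⁻ y in ball x ρ, ‖f y - ⨍ w in ball x ρ, f w ∂μ‖ₑ ^ q ∂μ) ^ (1 / q)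

/-- Membership in `BMO_b^q(μ)`. -/
def MemBMO (μ : Measure M) (q b : ℝ) (f : M → ℂ) : Prop :=
  Integrable f μ ∧ meanOscillation μ q b f < ∞

/-- The norm of `BMO_b^q(μ)`, namely `‖f‖₁ + N_b^q(f)`, for `f` in `BMO_b^q(μ)`. -/
def bmoNorm (μ : Measure M) (q b : ℝ) (f : M → ℂ) : ℝ :=
  ∫ y, ‖f y‖ ∂μ + (meanOscillation μ q b f).toReal

end Atoms

end

/-! Against a mean-zero atom on a ball `B`, a BMO function `f` enters only through `f - f_B`, so
Hölder's inequality bounds the pairing by the mean oscillation; the exceptional atom sees only the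
`L¹` norm. For unbounded `f`, however, `∫ f g` need not be computable term by term along an atomic
series, which converges only in `L¹`. For the bounded truncations `T_n f` it is, and since `T_n` is
1-Lipschitz, `|T_n f - T_n f_B| ≤ |f - f_B|` keeps the bound on atoms uniform in `n`. The functional
is the limit of these pairings, hence independent of any decomposition (`exists_dual_of_memBMO`).

Conversely, a functional `l` on the Hardy space is extended linearly, without continuity, to all of
`L¹`. On a ball `B` of radius at most `b`, mean-zero functions in `L^r(B)` are multiples of atoms,
and the extension has some finite value on the indicator of `B`; so `l` is bounded on `L^r(B)` and
Riesz representation applies. All local representatives come from the same functional, so they glue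
along a countable partition to a function `f₀` (`AtomicBound.exists_representation`). Testing
against mean-zero functions bounds the oscillation of `f₀` by `2‖l‖`.

The heart of the matter is the integrability of `f₀` up to a constant
(`exists_lintegral_norm_sub_le_of_oscillation`). Weighted means `F` of `f₀` at scale `s = b/2 > R₀`
are Lipschitz at that scale, and `f₀ - F` is integrable by a covering argument. Chains with steps at
most `s` bound `F - F(x₀)` on the exceptional ball `B₀`. For larger `t`, the set `{|F - F(x₀)| > t}`
is open and avoids the closure of `B₀`, so a fixed fraction of it lies in a thin inner collar, where
`|F - F(x₀)|` exceeds `t` by at most a fixed amount. The distribution function therefore decays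
geometrically, and `μ(M) < ∞` gives integrability. Standard atoms ignore constants; the value of `l`
at the exceptional atom determines the one to add. -/

/-! ### Chains of bounded step length. -/

section Chains

variable {M : Type*} [MetricSpace M]

/-- Under the approximate midpoint property any two points are joined by a chain with steps of
length at most `s`, for each `s > R₀`. -/
theorem ApproxMidpoint.reflTransGen {R₀ β : ℝ} (h : ApproxMidpoint M R₀ β) {s : ℝ} (hs : R₀ < s)
    (x y : M) : Relation.ReflTransGen (fun u v : M => dist u v ≤ s) x y := by
  obtain ⟨h0, h1, h2, h3⟩ := h
  have hs0 : 0 < s := h0.trans_lt hs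
  -- Each insertion of an approximate midpoint shrinks the gaps by the factor `β`; a gap of length
  -- at most `s` needs no further point, and a longer one exceeds `R₀`.
  have key : ∀ (n : ℕ) (x y : M), β ^ n * dist x y ≤ s →
      Relation.ReflTransGen (fun u v : M => dist u v ≤ s) x y := by
    intro n
    induction n with
    | zero => intro x y hxy; exact .single (by simpa using hxy)
    | succ n ih =>
      intro x y hxy
      rcases le_or_gt (dist x y) s with hle | hgt
      · exact .single hle
      obtain ⟨z, hz1, hz2⟩ := h3 x y (hs.trans hgt)
      have hβ : 0 ≤ β ^ n := by positivity
      refine (ih x z ?_).trans (ih z y ?_)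
      · calc β ^ n * dist x z ≤ β ^ n * (β * dist x y) := by gcongr
          _ = β ^ (n + 1) * dist x y := by ring
          _ ≤ s := hxy
      · calc β ^ n * dist z y ≤ β ^ n * (β * dist x y) := by rw [dist_comm z y]; gcongr
          _ = β ^ (n + 1) * dist x y := by ring
          _ ≤ s := hxy
  have ht : Filter.Tendsto (fun n : ℕ => β ^ n * dist x y) Filter.atTop (nhds (0 * dist x y)) :=
    (tendsto_pow_atTop_nhds_zero_of_lt_one (by linarith) h2).mul_const _
  rw [zero_mul] at ht
  obtain ⟨n, hn⟩ := (ht.eventually (gt_mem_nhds hs0)).exists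
  exact key n x y hn.le

/-- The triangle inequality along the chain. The number `n` is chosen before `F` and `A`, which
makes all later constants uniform in the function. -/
theorem exists_norm_sub_le_of_reflTransGen {s : ℝ} {x y : M}
    (h : Relation.ReflTransGen (fun u v : M => dist u v ≤ s) x y) :
    ∃ n : ℕ, ∀ (F : M → ℂ) (A : ℝ), (∀ u v, dist u v ≤ s → ‖F u - F v‖ ≤ A) →
      ‖F x - F y‖ ≤ n * A := by
  induction h with
  | refl => exact ⟨0, fun F A _ => by simp⟩
  | @tail u v _ huv ih =>
    obtain ⟨n, hn⟩ := ih
    refine ⟨n + 1, fun F A hF => ?_⟩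
    have h1 := hn F A hF
    have h2 := hF u v huv
    have h3 : ‖F x - F v‖ ≤ ‖F x - F u‖ + ‖F u - F v‖ := norm_sub_le_norm_sub_add_norm_sub _ _ _
    push_cast
    linarith

end Chains

/-! ### Consequences of local doubling: comparable balls, nets, oscillation on a fixed ball. -/

section Geometry

variable {M : Type*} [MetricSpace M] [MeasurableSpace M]

theorem LocallyDoubling.measure_ball_le_pow {μ : Measure M} (h : LocallyDoubling μ) {b : ℝ}
    (hb : 0 < b) (n : ℕ) : ∃ D : ℝ≥0, ∀ (x : M) (ρ : ℝ), 0 < ρ → ρ ≤ b →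
      μ (ball x (2 ^ n * ρ)) ≤ D * μ (ball x ρ) := by
  induction n with
  | zero => exact ⟨1, fun x ρ _ _ => by simp⟩
  | succ n ih =>
    obtain ⟨D, hD⟩ := ih
    obtain ⟨D', hD'⟩ := h (2 ^ n * b) (by positivity)
    refine ⟨D' * D, fun x ρ h0 h1 => ?_⟩
    calc μ (ball x (2 ^ (n + 1) * ρ)) = μ (ball x (2 * (2 ^ n * ρ))) := by congr 2; ring
      _ ≤ D' * μ (ball x (2 ^ n * ρ)) := hD' x _ (by positivity) (by gcongr)
      _ ≤ D' * (D * μ (ball x ρ)) := by gcongr; exact hD x ρ h0 h1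
      _ = _ := by push_cast; ring

/-- Balls of two fixed radii with the same centre have uniformly comparable measures. -/
theorem LocallyDoubling.exists_measure_ball_le {μ : Measure M} (h : LocallyDoubling μ)
    {s : ℝ} (hs : 0 < s) (R : ℝ) :
    ∃ D : ℝ≥0, ∀ x : M, μ (ball x R) ≤ D * μ (ball x s) := by
  obtain ⟨n, hn⟩ := pow_unbounded_of_one_lt (R / s) (one_lt_two : (1 : ℝ) < 2)
  obtain ⟨D, hD⟩ := h.measure_ball_le_pow hs n
  refine ⟨D, fun x => (measure_mono (ball_subset_ball ?_)).trans (hD x s hs le_rfl)⟩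
  rw [div_lt_iff₀ hs] at hn
  exact hn.le

/-- If one ball were null, doubling would make every concentric ball null, and these exhaust the
space. -/
theorem LocallyDoubling.measure_ball_pos {μ : Measure M} (h : LocallyDoubling μ) (hμ : μ ≠ 0)
    (x : M) {s : ℝ} (hs : 0 < s) : 0 < μ (ball x s) := by
  refine pos_iff_ne_zero.2 fun h0 => hμ ?_
  rw [← Measure.measure_univ_eq_zero, ← iUnion_ball_nat x, measure_iUnion_null_iff]
  intro n
  obtain ⟨D, hD⟩ := h.exists_measure_ball_le hs n
  simpa [h0] using hD x

theorem LocallyDoubling.exists_measureReal_ball_le {μ : Measure M} [IsFiniteMeasure μ]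
    (h : LocallyDoubling μ) {s : ℝ} (hs : 0 < s) (R : ℝ) :
    ∃ D : ℝ, 0 < D ∧ ∀ x : M, μ.real (ball x R) ≤ D * μ.real (ball x s) := by
  obtain ⟨D, hD⟩ := h.exists_measure_ball_le hs R
  refine ⟨D + 1, by positivity, fun x => ?_⟩
  have := ENNReal.toReal_mono (ENNReal.mul_ne_top ENNReal.coe_ne_top (measure_ne_top μ _)) (hD x)
  rw [ENNReal.toReal_mul, ENNReal.coe_toReal] at this
  have h0 : 0 ≤ μ.real (ball x s) := measureReal_nonneg
  simp only [Measure.real] at *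
  nlinarith

/-- A countable net at scale `s`, finite on bounded sets, with disjoint smaller balls. -/
theorem LocallyDoubling.exists_net [BorelSpace M] {μ : Measure M} [IsFiniteMeasure μ]
    (h : LocallyDoubling μ) (hμ : μ ≠ 0) {s : ℝ} (hs : 0 < s) :
    ∃ Z : Set M, Z.Countable ∧ (∀ x, ∃ z ∈ Z, dist x z < s) ∧
      Z.PairwiseDisjoint (fun z => ball z (s / 6)) ∧
      ∀ (x : M) (R : ℝ), {z ∈ Z | dist z x < R}.Finite := by
  -- Vitali selection among balls of the same radius `s / 6`: the enlargement factor 5 gives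
  -- covering distance `5 s / 6 < s`.
  obtain ⟨u, -, hdis, hcov⟩ := Vitali.exists_disjoint_subfamily_covering_enlargement_closedBall
    (univ : Set M) id (fun _ => s / 6) (s / 6) (fun _ _ => le_rfl) 5 (by norm_num)
  have hdis' : u.PairwiseDisjoint (fun z => ball z (s / 6)) :=
    hdis.mono fun z => ball_subset_closedBall
  have hdis'' : Pairwise (Function.onFun Disjoint fun z : u => ball (z : M) (s / 6)) :=
    fun a c hac => hdis' a.2 c.2 fun e => hac (Subtype.ext e)
  have hs6 : 0 < s / 6 := by positivity
  refine ⟨u, ?_, fun x => ?_, hdis', fun x R => ?_⟩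
  · have := Measure.countable_meas_pos_of_disjoint_iUnion (μ := μ)
      (As := fun z : u => ball (z : M) (s / 6)) (fun _ => measurableSet_ball) hdis''
    simp only [h.measure_ball_pos hμ _ hs6, ofPred_true, countable_univ_iff] at this
    exact Set.countable_coe_iff.1 this
  · obtain ⟨z, hz, hsub⟩ := hcov x (mem_univ _)
    refine ⟨z, hz, ?_⟩
    have : x ∈ closedBall z (5 * (s / 6)) := hsub (by simpa using hs6.le)
    rw [mem_closedBall] at this
    linarith
  · by_cases hR : 0 < R
    swap
    · convert Set.finite_empty (α := M)
      ext z
      simp only [mem_ofPred_eq, mem_empty_iff_false, iff_false, not_and]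
      intro _ h'
      linarith [dist_nonneg (x := z) (y := x)]
    -- Doubling bounds the small ball around each nearby net point below by a fixed positive amount,
    -- and a finite measure admits only finitely many such disjoint balls. The divisor `D + 1`
    -- avoids division by zero.
    obtain ⟨D, hD⟩ := h.exists_measure_ball_le hs6 (R + 1)
    have hfin := Measure.finite_const_le_meas_of_disjoint_iUnion μ
      (ε := μ (ball x 1) / (D + 1)) (As := fun z : u => ball (z : M) (s / 6))
      (ENNReal.div_pos (h.measure_ball_pos hμ x one_pos).ne' (by finiteness))
      (fun _ => measurableSet_ball) hdis'' (measure_ne_top μ _)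
    refine (hfin.image Subtype.val).subset ?_
    rintro z ⟨hz, hzx⟩
    refine ⟨⟨z, hz⟩, ?_, rfl⟩
    simp only [mem_ofPred_eq]
    refine ENNReal.div_le_of_le_mul ?_
    have h1 : ball x 1 ⊆ ball z (R + 1) := ball_subset_ball' (by rw [dist_comm]; linarith)
    calc μ (ball x 1) ≤ μ (ball z (R + 1)) := measure_mono h1
      _ ≤ D * μ (ball z (s / 6)) := hD z
      _ ≤ (D + 1) * μ (ball z (s / 6)) := by gcongr; exact le_self_add
      _ = _ := mul_comm _ _

/-- A function with oscillation at most `A` at scale `s > R₀` has oscillation at most `K A` on any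
given ball. -/
theorem exists_norm_sub_le_on_ball [BorelSpace M] {μ : Measure M} [IsFiniteMeasure μ]
    (h : LocallyDoubling μ) (hμ : μ ≠ 0) {R₀ β : ℝ} (hAM : ApproxMidpoint M R₀ β) {s : ℝ}
    (hs : R₀ < s) (x₀ : M) (R : ℝ) :
    ∃ K : ℝ, 0 ≤ K ∧ ∀ (F : M → ℂ) (A : ℝ), 0 ≤ A → (∀ u v, dist u v ≤ s → ‖F u - F v‖ ≤ A) →
      ∀ x ∈ ball x₀ R, ‖F x - F x₀‖ ≤ K * A := by
  have hs0 : 0 < s := hAM.1.trans_lt hs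
  obtain ⟨Z, -, hcov, -, hfin⟩ := h.exists_net hμ hs0
  -- Chain lengths to `x₀` are needed only for the finitely many net points near the ball; one
  -- further step joins `x` to the net.
  choose n hn using fun z : M => exists_norm_sub_le_of_reflTransGen (hAM.reflTransGen hs z x₀)
  obtain ⟨m, hm⟩ := ((hfin x₀ (R + s)).image n).bddAbove
  refine ⟨m + 1, by positivity, fun F A hA hF x hx => ?_⟩
  obtain ⟨z, hz, hxz⟩ := hcov x
  have hzx : dist z x₀ < R + s := by
    have := dist_triangle z x x₀
    rw [mem_ball] at hx
    rw [dist_comm z x] at this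
    linarith
  have hnm : n z ≤ m := hm ⟨z, ⟨hz, hzx⟩, rfl⟩
  have h1 := hn z F A hF
  have h2 := hF x z hxz.le
  have h3 : ‖F x - F x₀‖ ≤ ‖F x - F z‖ + ‖F z - F x₀‖ := norm_sub_le_norm_sub_add_norm_sub _ _ _
  have h4 : (n z : ℝ) * A ≤ m * A := by gcongr
  linarith

end Geometry

/-! ### Integrability from geometric decay of the distribution function. -/

section Decay

variable {M : Type*} [MeasurableSpace M]

/-- A function whose distribution function decays geometrically is integrable. -/
theorem lintegral_ofReal_le_of_geometric_decay {μ : Measure M} {G : M → ℝ} (hG : Measurable G)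
    {T d : ℝ} (hd : 0 < d) {q : ℝ≥0∞}
    (h : ∀ t, T ≤ t → μ {x | t + d < G x} ≤ q * μ {x | t < G x}) :
    ∫⁻ x, ENNReal.ofReal (G x) ∂μ ≤
      (ENNReal.ofReal T + ENNReal.ofReal d * (1 - q)⁻¹) * μ univ := by
  have hS : ∀ n : ℕ, MeasurableSet {x | T + n * d < G x} := fun n =>
    measurableSet_lt measurable_const hG
  have hpow : ∀ n : ℕ, μ {x | T + n * d < G x} ≤ q ^ n * μ univ := by
    intro n
    induction n with
    | zero => simpa using measure_mono (subset_univ _)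
    | succ n ih =>
      have h1 := h (T + n * d) (by have : 0 ≤ n * d := by positivity
                                   linarith)
      have h2 : T + ((n + 1 : ℕ) : ℝ) * d = T + n * d + d := by push_cast; ring
      rw [h2]
      calc _ ≤ q * μ {x | T + n * d < G x} := h1
        _ ≤ q * (q ^ n * μ univ) := by gcongr
        _ = _ := by ring
  -- Discrete layer cake: above `T`, the value `G x` is at most `T` plus `d` times the number of
  -- levels `T + n d` lying below it.
  have hpt : ∀ x, ENNReal.ofReal (G x) ≤ ENNReal.ofReal T +
      ∑' n : ℕ, {x | T + n * d < G x}.indicator (fun _ => ENNReal.ofReal d) x := by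
    intro x
    rcases le_or_gt (G x) T with hle | hgt
    · exact (ENNReal.ofReal_le_ofReal hle).trans le_self_add
    set N := ⌈(G x - T) / d⌉₊
    have h1 : G x ≤ T + N * d := by
      have := Nat.le_ceil ((G x - T) / d)
      rw [div_le_iff₀ hd] at this
      linarith
    have h2 : ∀ n ∈ Finset.range N,
        {x | T + n * d < G x}.indicator (fun _ => ENNReal.ofReal d) x = ENNReal.ofReal d := by
      intro n hn
      refine indicator_of_mem ?_ _
      have := Nat.lt_ceil.1 (Finset.mem_range.1 hn)
      rw [lt_div_iff₀ hd] at this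
      simp only [mem_ofPred_eq]
      linarith
    calc ENNReal.ofReal (G x) ≤ ENNReal.ofReal (T + N * d) := ENNReal.ofReal_le_ofReal h1
      _ ≤ ENNReal.ofReal T + ENNReal.ofReal (N * d) := ENNReal.ofReal_add_le
      _ = ENNReal.ofReal T + ∑ n ∈ Finset.range N,
          {x | T + n * d < G x}.indicator (fun _ => ENNReal.ofReal d) x := by
        rw [Finset.sum_congr rfl h2]
        simp [ENNReal.ofReal_mul]
      _ ≤ _ := by gcongr; exact ENNReal.sum_le_tsum _
  calc ∫⁻ x, ENNReal.ofReal (G x) ∂μ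
      ≤ ∫⁻ x, (ENNReal.ofReal T +
        ∑' n : ℕ, {x | T + n * d < G x}.indicator (fun _ => ENNReal.ofReal d) x) ∂μ :=
        lintegral_mono hpt
    _ = ENNReal.ofReal T * μ univ + ∑' n : ℕ, ENNReal.ofReal d * μ {x | T + n * d < G x} := by
        rw [lintegral_add_left measurable_const, lintegral_const, lintegral_tsum
          fun n => (measurable_const.indicator (hS n)).aemeasurable]
        congr 2
        ext n
        rw [lintegral_indicator_const (hS n)]
    _ ≤ ENNReal.ofReal T * μ univ + ∑' n : ℕ, ENNReal.ofReal d * (q ^ n * μ univ) := by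
        gcongr with n
        exact hpow n
    _ = _ := by
        rw [ENNReal.tsum_mul_left, ENNReal.tsum_mul_right, ENNReal.tsum_geometric]
        ring

end Decay

/-! ### Smoothing by Lipschitz bump means. -/

section Smoothing

theorem integrable_continuous_smul {M : Type*} [TopologicalSpace M] [MeasurableSpace M]
    [OpensMeasurableSpace M] {μ : Measure M} {S : Set M} {f : M → ℂ}
    (hf : IntegrableOn f S μ) {k : M → ℝ} (hk : Continuous k) {c : ℝ} (hkc : ∀ w, |k w| ≤ c)
    (hk0 : ∀ w, w ∉ S → k w = 0) : Integrable (fun w => k w • f w) μ := by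
  have h1 : IntegrableOn (fun w => k w • f w) S μ :=
    Integrable.bdd_smul hf c hk.aestronglyMeasurable (ae_of_all _ fun w => hkc w)
  exact h1.integrable_of_forall_notMem_eq_zero fun w hw => by simp [hk0 w hw]

theorem norm_integral_smul_le {M : Type*} [MeasurableSpace M] {μ : Measure M} {S : Set M}
    {f : M → ℂ}
    (hf : IntegrableOn f S μ) {k : M → ℝ} {c : ℝ} (hkc : ∀ w, |k w| ≤ c)
    (hk0 : ∀ w, w ∉ S → k w = 0) : ‖∫ w, k w • f w ∂μ‖ ≤ c * ∫ w in S, ‖f w‖ ∂μ := by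
  rw [← setIntegral_eq_integral_of_forall_compl_eq_zero (s := S) fun w hw => by simp [hk0 w hw],
    ← integral_const_mul]
  refine norm_integral_le_of_norm_le (hf.norm.const_mul c) (ae_of_all _ fun w => ?_)
  rw [norm_smul]
  gcongr
  exact hkc w

variable {M : Type*} [MetricSpace M]

/-- The Lipschitz bump function at scale `s` around `y`. -/
noncomputable def bump (s : ℝ) (y w : M) : ℝ := max 0 (1 - dist y w / s)

theorem bump_nonneg (s : ℝ) (y w : M) : 0 ≤ bump s y w := le_max_left _ _

theorem bump_le_one {s : ℝ} (hs : 0 < s) (y w : M) : bump s y w ≤ 1 := by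
  have : 0 ≤ dist y w / s := by positivity
  exact max_le zero_le_one (by linarith)

theorem bump_eq_zero {s : ℝ} (hs : 0 < s) {y w : M} (h : w ∉ ball y s) : bump s y w = 0 := by
  rw [mem_ball, dist_comm, not_lt] at h
  have : 1 ≤ dist y w / s := by rwa [one_le_div hs]
  exact max_eq_left (by linarith)

theorem half_le_bump {s : ℝ} (hs : 0 < s) {y w : M} (h : w ∈ ball y (s / 2)) :
    1 / 2 ≤ bump s y w := by
  rw [mem_ball, dist_comm] at h
  have : dist y w / s ≤ 1 / 2 := by rw [div_le_iff₀ hs]; linarith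
  exact le_max_of_le_right (by linarith)

theorem abs_bump_sub_le {s : ℝ} (hs : 0 < s) (x y w : M) :
    |bump s x w - bump s y w| ≤ dist x y / s := by
  refine (abs_max_sub_max_le_max 0 _ 0 _).trans ?_
  simp only [sub_self, abs_zero]
  refine max_le (by positivity) ?_
  rw [show 1 - dist x w / s - (1 - dist y w / s) = (dist y w - dist x w) / s by ring, abs_div,
    abs_of_pos hs]
  gcongr
  rw [dist_comm x y]
  exact abs_dist_sub_le y x w

theorem continuous_bump (s : ℝ) (y : M) : Continuous (bump s y) := by
  unfold bump; fun_prop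

variable [MeasurableSpace M] [BorelSpace M]

/-- The mean of `f` with respect to the bump function around `y`. -/
noncomputable def bumpMean (μ : Measure M) (s : ℝ) (f : M → ℂ) (y : M) : ℂ :=
  (∫ w, bump s y w ∂μ)⁻¹ • ∫ w, bump s y w • f w ∂μ

variable {μ : Measure M} [IsFiniteMeasure μ]

theorem integrable_bump {s : ℝ} (hs : 0 < s) (y : M) : Integrable (bump s y) μ :=
  Integrable.of_bound (continuous_bump s y).aestronglyMeasurable 1
    (ae_of_all _ fun w => by
      rw [Real.norm_of_nonneg (bump_nonneg s y w)]; exact bump_le_one hs y w)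

theorem half_mul_measureReal_le_integral_bump {s : ℝ} (hs : 0 < s) (y : M) :
    1 / 2 * μ.real (ball y (s / 2)) ≤ ∫ w, bump s y w ∂μ := by
  calc 1 / 2 * μ.real (ball y (s / 2))
      = ∫ w, (ball y (s / 2)).indicator (fun _ => (1 / 2 : ℝ)) w ∂μ := by
        rw [integral_indicator_const _ measurableSet_ball, smul_eq_mul, mul_comm]
    _ ≤ _ := by
        refine integral_mono ((integrable_const _).indicator measurableSet_ball)
          (integrable_bump hs y) fun w => ?_
        by_cases hw : w ∈ ball y (s / 2)
        · rw [indicator_of_mem hw]; exact half_le_bump hs hw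
        · rw [indicator_of_notMem hw]; exact bump_nonneg s y w

/-- Comparison of `bumpMean` with an arbitrary constant on a ball of twice the scale. -/
theorem bumpMean_sub {s : ℝ} (hs : 0 < s) {f : M → ℂ} {x : M}
    (hf : IntegrableOn f (ball x (2 * s)) μ) (m : ℂ) {y : M} (hxy : dist x y ≤ s)
    (hI : 0 < ∫ w, bump s y w ∂μ) :
    bumpMean μ s f y - m = (∫ w, bump s y w ∂μ)⁻¹ • ∫ w, bump s y w • (f w - m) ∂μ := by
  have h0 : ∀ w, w ∉ ball x (2 * s) → bump s y w = 0 := fun w hw =>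
    bump_eq_zero hs fun h => hw (ball_subset_ball' (by rw [dist_comm]; linarith) h)
  have h1 : ∀ w, |bump s y w| ≤ 1 := fun w => by
    rw [abs_of_nonneg (bump_nonneg s y w)]; exact bump_le_one hs y w
  simp only [smul_sub]
  rw [integral_sub (integrable_continuous_smul hf (continuous_bump s y) h1 h0)
    ((integrable_bump hs y).smul_const m), integral_smul_const, smul_sub, smul_smul,
    inv_mul_cancel₀ hI.ne', one_smul, bumpMean]

/-- Local oscillation bounds for `f` on balls of radius `2 s` give bounds for `bumpMean`. -/
theorem bumpMean_bounds {s : ℝ} (hs : 0 < s) {E A : ℝ} (hE : 0 ≤ E) (hA : 0 ≤ A) {f : M → ℂ}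
    (hI : ∀ y : M, 0 < ∫ w, bump s y w ∂μ)
    (hIE : ∀ x y : M, dist x y ≤ s → μ.real (ball x (2 * s)) ≤ E * ∫ w, bump s y w ∂μ)
    (hf : ∀ x, IntegrableOn f (ball x (2 * s)) μ) {m : M → ℂ}
    (hm : ∀ x, ∫ w in ball x (2 * s), ‖f w - m x‖ ∂μ ≤ A * μ.real (ball x (2 * s))) :
    (∀ x y, dist x y ≤ s → ‖bumpMean μ s f y - m x‖ ≤ E * A) ∧
    ∀ x y, dist x y ≤ s →
      ‖bumpMean μ s f x - bumpMean μ s f y‖ ≤ dist x y / s * ((E + E * E) * A) := by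
  have hfm : ∀ x, IntegrableOn (fun w => f w - m x) (ball x (2 * s)) μ := fun x =>
    (hf x).sub (integrable_const _)
  have h0 : ∀ x y : M, dist x y ≤ s → ∀ w, w ∉ ball x (2 * s) → bump s y w = 0 :=
    fun x y hxy w hw => bump_eq_zero hs fun h => hw (ball_subset_ball' (by rw [dist_comm]; linarith) h)
  have h1 : ∀ y w : M, |bump s y w| ≤ 1 := fun y w => by
    rw [abs_of_nonneg (bump_nonneg s y w)]; exact bump_le_one hs y w
  have key : ∀ x y : M, dist x y ≤ s → ‖bumpMean μ s f y - m x‖ ≤ E * A := by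
    intro x y hxy
    rw [bumpMean_sub hs (hf x) (m x) hxy (hI y), norm_smul, norm_inv, Real.norm_of_nonneg (hI y).le,
      inv_mul_le_iff₀ (hI y)]
    calc _ ≤ 1 * ∫ w in ball x (2 * s), ‖f w - m x‖ ∂μ :=
          norm_integral_smul_le (hfm x) (h1 y) (h0 x y hxy)
      _ ≤ A * μ.real (ball x (2 * s)) := by rw [one_mul]; exact hm x
      _ ≤ A * (E * ∫ w, bump s y w ∂μ) := by gcongr; exact hIE x y hxy
      _ = _ := by ring
  refine ⟨key, fun x y hxy => ?_⟩
  have hxx : dist x x ≤ s := by simpa using hs.le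
  set V := μ.real (ball x (2 * s))
  set δ := dist x y / s
  have hδ : 0 ≤ δ := by positivity
  have hV : V ≤ E * ∫ w, bump s x w ∂μ := hIE x x hxx
  have hd0 : ∀ w, w ∉ ball x (2 * s) → bump s x w - bump s y w = 0 := fun w hw => by
    rw [h0 x x hxx w hw, h0 x y hxy w hw, sub_self]
  have hdI : ‖(∫ w, bump s y w ∂μ) - ∫ w, bump s x w ∂μ‖ ≤ δ * V := by
    rw [← integral_sub (integrable_bump hs y) (integrable_bump hs x),
      ← setIntegral_eq_integral_of_forall_compl_eq_zero (s := ball x (2 * s)) fun w hw => by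
        rw [← neg_sub, hd0 w hw, neg_zero]]
    refine norm_setIntegral_le_of_norm_le_const (measure_lt_top _ _) fun w _ => ?_
    rw [← norm_neg, neg_sub]
    exact abs_bump_sub_le hs x y w
  have hJ : ‖(∫ w, bump s x w • (f w - m x) ∂μ) - ∫ w, bump s y w • (f w - m x) ∂μ‖
      ≤ δ * (A * V) := by
    rw [← integral_sub (integrable_continuous_smul (hfm x) (continuous_bump s x)
      (h1 x) (h0 x x hxx)) (integrable_continuous_smul (hfm x)
      (continuous_bump s y) (h1 y) (h0 x y hxy))]
    simp only [← sub_smul]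
    refine (norm_integral_smul_le (hfm x) (abs_bump_sub_le hs x y) hd0).trans ?_
    gcongr
    exact hm x
  -- A quotient rule with the constant `m x` subtracted first, so that the changes of numerator and
  -- denominator are both measured against the oscillation of `f` and not its size.
  have hid : bumpMean μ s f x - bumpMean μ s f y =
      (∫ w, bump s x w ∂μ)⁻¹ •
        (((∫ w, bump s x w • (f w - m x) ∂μ) - ∫ w, bump s y w • (f w - m x) ∂μ) +
        ((∫ w, bump s y w ∂μ) - ∫ w, bump s x w ∂μ) • (bumpMean μ s f y - m x)) := by
    have e1 := bumpMean_sub hs (hf x) (m x) hxx (hI x)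
    have e2 := bumpMean_sub hs (hf x) (m x) hxy (hI y)
    have e3 : ∫ w, bump s y w • (f w - m x) ∂μ =
        (∫ w, bump s y w ∂μ) • (bumpMean μ s f y - m x) := by
      rw [e2, smul_inv_smul₀ (hI y).ne']
    rw [e3, sub_smul, sub_add_sub_cancel, smul_sub, ← e1, inv_smul_smul₀ (hI x).ne']
    ring
  rw [hid, norm_smul, norm_inv, Real.norm_of_nonneg (hI x).le, inv_mul_le_iff₀ (hI x)]
  calc _ ≤ δ * (A * V) + δ * V * (E * A) := by
        refine (norm_add_le _ _).trans (add_le_add hJ ?_)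
        rw [norm_smul]
        gcongr
        exact key x y hxy
    _ = δ * A * (1 + E) * V := by ring
    _ ≤ δ * A * (1 + E) * (E * ∫ w, bump s x w ∂μ) := by gcongr
    _ = _ := by ring

end Smoothing

/-! ### Bounded oscillation implies integrability up to a constant. -/

section IntegrableOscillation

variable {M : Type*} [MetricSpace M] [MeasurableSpace M] [BorelSpace M]

/-- Exponential integrability of functions that are Lipschitz at a fixed scale, as a consequence of
the complementary isoperimetric property. -/
theorem exists_lintegral_norm_sub_le_of_lipschitz {μ : Measure M} [IsFiniteMeasure μ]
    (hLD : LocallyDoubling μ) (hμ : μ ≠ 0) {R₀ β : ℝ} (hAM : ApproxMidpoint M R₀ β)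
    (hCI : ComplIsoperimetric μ) {s : ℝ} (hs : R₀ < s) :
    ∃ C : ℝ≥0∞, C ≠ ∞ ∧ ∃ x₀ : M, ∀ (F : M → ℂ) (A : ℝ), 0 < A → Continuous F →
      (∀ x y, dist x y ≤ s → ‖F x - F y‖ ≤ dist x y * A) →
      ∫⁻ x, ‖F x - F x₀‖ₑ ∂μ ≤ C * ENNReal.ofReal A := by
  obtain ⟨x₀, R, κ₀, c, hR, hκ₀, hc, hiso⟩ := hCI
  have hs0 : 0 < s := hAM.1.trans_lt hs
  obtain ⟨K, hK0, hK⟩ := exists_norm_sub_le_on_ball hLD hμ hAM hs x₀ (R + 1)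
  set κ := min κ₀ (min (s / 2) (1 / (2 * c))) with hκdef
  have hκ : 0 < κ := by positivity
  have hκs : 2 * κ ≤ s := by
    have : κ ≤ s / 2 := (min_le_right _ _).trans (min_le_left _ _)
    linarith
  have hκc : c * κ ≤ 1 / 2 := by
    have : κ ≤ 1 / (2 * c) := (min_le_right _ _).trans (min_le_right _ _)
    calc c * κ ≤ c * (1 / (2 * c)) := by gcongr
      _ = 1 / 2 := by field_simp
  have hq : 1 - (1 - ENNReal.ofReal (c * κ)) ≠ 0 := by
    rw [ENNReal.sub_sub_cancel ENNReal.one_ne_top]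
    · exact (ENNReal.ofReal_pos.2 (by positivity)).ne'
    · rw [ENNReal.ofReal_le_one]; linarith
  refine ⟨(ENNReal.ofReal (K * s) + ENNReal.ofReal (2 * κ) *
    (1 - (1 - ENNReal.ofReal (c * κ)))⁻¹) * μ univ, by finiteness, x₀, fun F A hA hFc hF => ?_⟩
  set G : M → ℝ := fun x => ‖F x - F x₀‖ with hG
  have hGc : Continuous G := by fun_prop
  have hclos : ∀ x ∈ closure (ball x₀ R), G x ≤ K * (s * A) := by
    intro x hx
    refine hK F (s * A) (by positivity) (fun u v huv => (hF u v huv).trans (by gcongr)) x ?_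
    have := closure_ball_subset_closedBall hx
    rw [mem_closedBall] at this
    rw [mem_ball]
    linarith
  -- The set above level `t` loses at least the fraction `c κ` of its measure when the level rises
  -- by `2 κ A`, because its collar is left behind.
  have hdecay : ∀ t, K * (s * A) ≤ t → μ {x | t + 2 * κ * A < G x} ≤
      (1 - ENNReal.ofReal (c * κ)) * μ {x | t < G x} := by
    intro t ht
    set S := {x | t < G x} with hS
    have hSo : IsOpen S := isOpen_lt continuous_const hGc
    have h1 := hiso S hSo (fun x hx hx' => by
      have := hclos x hx'
      rw [hS, mem_ofPred_eq] at hx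
      linarith) κ hκ (min_le_left _ _)
    have hsub : innerCollar S κ ⊆ S \ {x | t + 2 * κ * A < G x} := by
      rintro x ⟨hxS, hx⟩
      refine ⟨hxS, ?_⟩
      -- The distance to the complement need not be attained; relaxing `κ` to `2 κ` supplies an
      -- actual point `y` outside `S`.
      have h2 : infEDist x Sᶜ < ENNReal.ofReal (2 * κ) :=
        hx.trans_lt ((ENNReal.ofReal_lt_ofReal_iff (by positivity)).2 (by linarith))
      obtain ⟨y, hy, hxy⟩ := infEDist_lt_iff.1 h2
      rw [edist_lt_ofReal] at hxy
      have h3 := hF x y (hxy.le.trans hκs)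
      have h4 : G y ≤ t := not_lt.1 hy
      have h5 : G x ≤ ‖F x - F y‖ + G y := norm_sub_le_norm_sub_add_norm_sub _ _ _
      have h6 : dist x y * A ≤ 2 * κ * A := by gcongr
      simp only [mem_ofPred_eq, not_lt]
      linarith
    have h7 : {x | t + 2 * κ * A < G x} ⊆ S := fun x hx => by
      simp only [hS, mem_ofPred_eq] at hx ⊢
      have : 0 < 2 * κ * A := by positivity
      linarith
    have hm : MeasurableSet {x | t + 2 * κ * A < G x} :=
      (isOpen_lt continuous_const hGc).measurableSet
    have h8 : μ (S \ {x | t + 2 * κ * A < G x}) = μ S - μ {x | t + 2 * κ * A < G x} :=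
      measure_sdiff h7 hm.nullMeasurableSet (measure_ne_top _ _)
    have h9 := h1.trans (measure_mono hsub)
    rw [h8] at h9
    rw [ENNReal.sub_mul (fun _ _ => measure_ne_top _ _), one_mul]
    refine ENNReal.le_sub_of_add_le_left (by finiteness) ?_
    exact (add_le_add_left h9 _).trans_eq (tsub_add_cancel_of_le (measure_mono h7))
  have := lintegral_ofReal_le_of_geometric_decay hGc.measurable (by positivity) hdecay
  simp only [hG, ofReal_norm] at this
  refine this.trans_eq ?_
  rw [← mul_assoc, ENNReal.ofReal_mul (p := K * s) (by positivity),
    ENNReal.ofReal_mul (p := 2 * κ) (by positivity)]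
  ring

/-- A locally integrable function with bounded mean oscillation at the scale `2 s > 2 R₀` differs
from a constant by an integrable function, with a uniform bound. -/
theorem exists_lintegral_norm_sub_le_of_oscillation {μ : Measure M} [IsFiniteMeasure μ]
    (hLD : LocallyDoubling μ) (hμ : μ ≠ 0) {R₀ β : ℝ} (hAM : ApproxMidpoint M R₀ β)
    (hCI : ComplIsoperimetric μ) {s : ℝ} (hs : R₀ < s) :
    ∃ C : ℝ≥0∞, C ≠ ∞ ∧ ∀ (f : M → ℂ) (m : M → ℂ) (A : ℝ), 0 < A →
      (∀ x, IntegrableOn f (ball x (2 * s)) μ) →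
      (∀ x, ∫ w in ball x (2 * s), ‖f w - m x‖ ∂μ ≤ A * μ.real (ball x (2 * s))) →
      ∃ c : ℂ, ∫⁻ x, ‖f x - c‖ₑ ∂μ ≤ C * ENNReal.ofReal A := by
  have hs0 : 0 < s := hAM.1.trans_lt hs
  obtain ⟨C, hC, x₀, hlip⟩ := exists_lintegral_norm_sub_le_of_lipschitz hLD hμ hAM hCI hs
  -- For `dist x y ≤ s`, the ball of radius `2 s` at `x` lies in that of radius `3 s` at `y`, while
  -- the bump at `y` is at least `1 / 2` on radius `s / 2`. Hence the comparison constant `E = 2 *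
  -- D`.
  obtain ⟨D, hD0, hD⟩ := hLD.exists_measureReal_ball_le (half_pos hs0) (3 * s)
  obtain ⟨D', hD'⟩ := hLD.exists_measure_ball_le (show 0 < s / 6 by positivity) (2 * s)
  obtain ⟨Z, hZc, hZcov, hZdis, -⟩ := hLD.exists_net hμ hs0
  have hI : ∀ y : M, 0 < ∫ w, bump s y w ∂μ := fun y => by
    have h1 : 0 < μ.real (ball y (s / 2)) :=
      ENNReal.toReal_pos (hLD.measure_ball_pos hμ y (by positivity)).ne' (measure_ne_top _ _)
    linarith [half_mul_measureReal_le_integral_bump (μ := μ) hs0 y]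
  have hIE : ∀ x y : M, dist x y ≤ s →
      μ.real (ball x (2 * s)) ≤ 2 * D * ∫ w, bump s y w ∂μ := fun x y hxy => by
    have h1 : μ.real (ball x (2 * s)) ≤ μ.real (ball y (3 * s)) :=
      measureReal_mono (ball_subset_ball' (by linarith))
    have h2 := half_mul_measureReal_le_integral_bump (μ := μ) hs0 y
    have h3 := hD y
    nlinarith
  set E := 2 * D
  have hE : 0 < E := by positivity
  refine ⟨ENNReal.ofReal (1 + E) * D' * μ univ + C * ENNReal.ofReal (s⁻¹ * (E + E * E)),
    by finiteness, fun f m A hA hf hm => ?_⟩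
  obtain ⟨hb1, hb2⟩ := bumpMean_bounds hs0 hE.le hA.le hI hIE hf hm
  set F := bumpMean μ s f
  have hFlip : ∀ x y, dist x y ≤ s → ‖F x - F y‖ ≤ dist x y * (s⁻¹ * (E + E * E) * A) :=
    fun x y hxy => (hb2 x y hxy).trans_eq (by ring)
  have hB : 0 < s⁻¹ * (E + E * E) * A := by positivity
  have hFc : Continuous F := by
    refine continuous_iff_continuousAt.2 fun x => ?_
    refine continuousAt_of_locally_lipschitz hs0 (s⁻¹ * (E + E * E) * A) fun y hy => ?_
    rw [dist_eq_norm, mul_comm]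
    exact hFlip y x hy.le
  have h1 := hlip F _ hB hFc hFlip
  have h2 : ∫⁻ x, ‖f x - F x‖ₑ ∂μ ≤ ENNReal.ofReal (1 + E) * D' * μ univ * ENNReal.ofReal A := by
    -- On a net ball, `m z` is an intermediary between `f` and `F`. The local bounds are then
    -- summable: the balls of radius `2 s` overlap, but doubling compares them with the disjoint
    -- ones of radius `s / 6`.
    have hloc : ∀ z, ∫⁻ x in ball z s, ‖f x - F x‖ₑ ∂μ ≤
        ENNReal.ofReal ((1 + E) * A) * μ (ball z (2 * s)) := by
      intro z
      have hsub : ball z s ⊆ ball z (2 * s) := ball_subset_ball (by linarith)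
      have hfm : IntegrableOn (fun x => ‖f x - m z‖) (ball z (2 * s)) μ :=
        ((hf z).sub (integrable_const _)).norm
      calc ∫⁻ x in ball z s, ‖f x - F x‖ₑ ∂μ
          ≤ ∫⁻ x in ball z s, ENNReal.ofReal (‖f x - m z‖ + E * A) ∂μ := by
            refine setLIntegral_mono' measurableSet_ball fun x hx => ?_
            rw [← ofReal_norm]
            refine ENNReal.ofReal_le_ofReal ?_
            have := hb1 z x (by rw [dist_comm]; exact (mem_ball.1 hx).le)
            rw [norm_sub_rev] at this
            linarith [norm_sub_le_norm_sub_add_norm_sub (f x) (m z) (F x)]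
        _ ≤ ∫⁻ x in ball z (2 * s), ENNReal.ofReal (‖f x - m z‖ + E * A) ∂μ :=
            lintegral_mono_set hsub
        _ = ENNReal.ofReal (∫ x in ball z (2 * s), (‖f x - m z‖ + E * A) ∂μ) := by
            rw [ofReal_integral_eq_lintegral_ofReal
              (f := fun x => ‖f x - m z‖ + E * A) (hfm.add (integrable_const _))
              (ae_of_all _ fun x => by positivity)]
        _ ≤ ENNReal.ofReal ((1 + E) * A * μ.real (ball z (2 * s))) := by
            refine ENNReal.ofReal_le_ofReal ?_
            rw [integral_add hfm (integrable_const _), setIntegral_const, smul_eq_mul]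
            linarith [hm z]
        _ = _ := by rw [ENNReal.ofReal_mul (by positivity), ofReal_measureReal]
    have hcov : (⋃ z : Z, ball (z : M) s) = univ := eq_univ_of_forall fun x => by
      obtain ⟨z, hz, hxz⟩ := hZcov x
      exact mem_iUnion.2 ⟨⟨z, hz⟩, hxz⟩
    have := hZc.to_subtype
    calc ∫⁻ x, ‖f x - F x‖ₑ ∂μ = ∫⁻ x in ⋃ z : Z, ball (z : M) s, ‖f x - F x‖ₑ ∂μ := by
          rw [hcov, setLIntegral_univ]
      _ ≤ ∑' z : Z, ∫⁻ x in ball (z : M) s, ‖f x - F x‖ₑ ∂μ := lintegral_iUnion_le _ _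
      _ ≤ ∑' z : Z, ENNReal.ofReal ((1 + E) * A) * (D' * μ (ball (z : M) (s / 6))) := by
          refine ENNReal.tsum_le_tsum fun z => (hloc z).trans ?_
          gcongr
          exact hD' z
      _ = ENNReal.ofReal ((1 + E) * A) * (D' * μ (⋃ z : Z, ball (z : M) (s / 6))) := by
          rw [ENNReal.tsum_mul_left, ENNReal.tsum_mul_left, measure_iUnion
            (f := fun z : Z => ball (z : M) (s / 6))
            (fun a c hac => hZdis a.2 c.2 fun e => hac (Subtype.ext e))
            fun _ => measurableSet_ball]
      _ ≤ ENNReal.ofReal ((1 + E) * A) * (D' * μ univ) := by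
          gcongr
          exact subset_univ _
      _ = _ := by rw [ENNReal.ofReal_mul (by positivity)]; ring
  refine ⟨F x₀, ?_⟩
  calc ∫⁻ x, ‖f x - F x₀‖ₑ ∂μ ≤ ∫⁻ x, (‖f x - F x‖ₑ + ‖F x - F x₀‖ₑ) ∂μ := by
        refine lintegral_mono fun x => ?_
        rw [← sub_add_sub_cancel (f x) (F x) (F x₀)]
        exact enorm_add_le _ _
    _ = (∫⁻ x, ‖f x - F x‖ₑ ∂μ) + ∫⁻ x, ‖F x - F x₀‖ₑ ∂μ :=
        lintegral_add_right _ (by fun_prop)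
    _ ≤ _ := by
        refine (add_le_add h2 h1).trans_eq ?_
        rw [ENNReal.ofReal_mul (p := s⁻¹ * (E + E * E)) (by positivity)]
        ring

end IntegrableOscillation

/-! ### Extremal test functions for the `L^q` norm. -/

section DualTest

variable {α : Type*}

/-- The truncated function that tests the `L^q` norm of `f`. -/
noncomputable def dualTest (f : α → ℂ) (q : ℝ) (n : ℕ) (x : α) : ℂ :=
  if ‖f x‖ ≤ n then (starRingEnd ℂ) (f x) * ((‖f x‖ ^ (q - 2) : ℝ) : ℂ) else 0

/-- The exponent `q - 2` may be negative, but the factor `conj f` vanishes where `f` does. Since `(q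
- 1) p = q`, the `p`-th power of this norm is again the truncated `‖f‖ ^ q`. -/
theorem norm_dualTest {f : α → ℂ} {q : ℝ} (hq : 1 < q) (n : ℕ) (x : α) :
    ‖dualTest f q n x‖ = if ‖f x‖ ≤ n then ‖f x‖ ^ (q - 1) else 0 := by
  unfold dualTest
  split_ifs with h
  · rw [norm_mul, RCLike.norm_conj, Complex.norm_real, Real.norm_of_nonneg (by positivity)]
    rcases eq_or_ne (‖f x‖) 0 with h0 | h0
    · rw [h0, zero_mul, Real.zero_rpow (by linarith)]
    · rw [show q - 1 = 1 + (q - 2) by ring, Real.rpow_add (lt_of_le_of_ne (norm_nonneg _) h0.symm),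
        Real.rpow_one]
  · simp

theorem mul_dualTest {f : α → ℂ} {q : ℝ} (hq : 1 < q) (n : ℕ) (x : α) :
    f x * dualTest f q n x = ((if ‖f x‖ ≤ n then ‖f x‖ ^ q else 0 : ℝ) : ℂ) := by
  unfold dualTest
  split_ifs with h
  · rw [← mul_assoc, Complex.mul_conj, Complex.normSq_eq_norm_sq, ← Complex.ofReal_mul]
    congr 1
    rcases eq_or_ne (‖f x‖) 0 with h0 | h0
    · rw [h0, Real.zero_rpow (show q ≠ 0 by linarith)]; simp
    · have hpos := lt_of_le_of_ne (norm_nonneg _) h0.symm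
      rw [← Real.rpow_natCast, ← Real.rpow_add hpos]
      congr 1
      push_cast
      ring
  · simp

end DualTest

/-! ### Converse Hölder inequality and Riesz representation. -/

section LpDuality

variable {α : Type*} [MeasurableSpace α] {ν : Measure α} [IsFiniteMeasure ν]

/-- Divide by `X ^ (1 / p)`. This needs `X` finite, which is why truncated test functions are used.
-/
theorem le_of_le_mul_rpow {X C : ℝ≥0∞} {p q : ℝ} (hpq : p.HolderConjugate q) (hX : X ≠ ∞)
    (h : X ≤ C * X ^ (1 / p)) : X ^ (1 / q) ≤ C := by
  rcases eq_or_ne X 0 with rfl | h0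
  · rw [ENNReal.zero_rpow_of_pos (one_div_pos.2 hpq.symm.pos)]
    exact zero_le
  have hs : X = X ^ (1 / q) * X ^ (1 / p) := by
    rw [← ENNReal.rpow_add _ _ h0 hX, one_div, one_div, add_comm, hpq.inv_add_inv_eq_one,
      ENNReal.rpow_one]
  have h1 : X ^ (1 / p) ≠ 0 := by simp [h0, hX]
  have h2 : X ^ (1 / p) ≠ ∞ := ENNReal.rpow_ne_top_of_nonneg (one_div_nonneg.2 hpq.pos.le) hX
  rw [← ENNReal.mul_le_mul_iff_left h1 h2, ← hs]
  exact h

/-- An `L^q` bound by duality with bounded functions. -/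
theorem eLpNorm_le_of_forall_bounded {p q : ℝ} (hpq : p.HolderConjugate q) {f : α → ℂ}
    (hf : AEStronglyMeasurable f ν) {C : ℝ≥0∞}
    (h : ∀ g : α → ℂ, StronglyMeasurable g → (∃ K : ℝ, ∀ x, ‖g x‖ ≤ K) →
      ‖∫ x, f x * g x ∂ν‖ₑ ≤ C * eLpNorm g (ENNReal.ofReal p) ν) :
    eLpNorm f (ENNReal.ofReal q) ν ≤ C := by
  wlog hfs : StronglyMeasurable f generalizing f
  · rw [eLpNorm_congr_ae hf.ae_eq_mk]
    refine this hf.stronglyMeasurable_mk.aestronglyMeasurable (fun g hg hK => ?_)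
      hf.stronglyMeasurable_mk
    rw [← integral_congr_ae (hf.ae_eq_mk.mono fun x hx => by
      simp only [hx] : (fun x => f x * g x) =ᵐ[ν] fun x => hf.mk f x * g x)]
    exact h g hg hK
  have hq1 : 1 < q := hpq.symm.lt
  have hq0 : 0 < q := hpq.symm.pos
  have hp0 : 0 < p := hpq.pos
  set φ : ℕ → α → ℝ := fun n x => if ‖f x‖ ≤ n then ‖f x‖ ^ q else 0 with hφ
  have hφ0 : ∀ n x, 0 ≤ φ n x := fun n x => by simp only [hφ]; split_ifs <;> positivity
  have hmeasle : ∀ n : ℕ, MeasurableSet {x | ‖f x‖ ≤ n} := fun n =>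
    measurableSet_le hfs.measurable.norm measurable_const
  have hφm : ∀ n, Measurable (φ n) := fun n =>
    Measurable.ite (hmeasle n) (hfs.measurable.norm.pow_const _) measurable_const
  have hφle : ∀ n x, φ n x ≤ (n : ℝ) ^ q := fun n x => by
    simp only [hφ]
    split_ifs with h1
    · gcongr
    · positivity
  set X : ℕ → ℝ≥0∞ := fun n => ∫⁻ x, ENNReal.ofReal (φ n x) ∂ν with hX
  have hXtop : ∀ n, X n ≠ ∞ := fun n => by
    refine (lt_of_le_of_lt (lintegral_mono fun x => ENNReal.ofReal_le_ofReal (hφle n x)) ?_).ne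
    rw [lintegral_const]
    finiteness
  -- With the extremal test function, the pairing equals `X n` and the `L^p` norm is `X n ^ (1 /
  -- p)`.
  have hXC : ∀ n, X n ^ (1 / q) ≤ C := by
    intro n
    refine le_of_le_mul_rpow hpq (hXtop n) ?_
    have hgm : StronglyMeasurable (dualTest f q n) := by
      refine Measurable.stronglyMeasurable ?_
      refine Measurable.ite (hmeasle n) ?_ measurable_const
      have := hfs.measurable
      fun_prop
    have h1 := h (dualTest f q n) hgm ⟨(n : ℝ) ^ (q - 1), fun x => by
      rw [norm_dualTest hq1]
      split_ifs with h1
      · gcongr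
      · positivity⟩
    have h2 : ∫ x, f x * dualTest f q n x ∂ν = ((∫ x, φ n x ∂ν : ℝ) : ℂ) := by
      rw [← integral_complex_ofReal]
      exact integral_congr_ae (ae_of_all _ fun x => mul_dualTest hq1 n x)
    have h3 : ‖∫ x, f x * dualTest f q n x ∂ν‖ₑ = X n := by
      rw [h2, ← ofReal_norm, Complex.norm_real, Real.norm_of_nonneg (integral_nonneg (hφ0 n)),
        ofReal_integral_eq_lintegral_ofReal _ (ae_of_all _ (hφ0 n))]
      exact Integrable.of_bound (hφm n).aestronglyMeasurable ((n : ℝ) ^ q) (ae_of_all _ fun x => by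
        rw [Real.norm_of_nonneg (hφ0 n x)]; exact hφle n x)
    have h4 : eLpNorm (dualTest f q n) (ENNReal.ofReal p) ν = X n ^ (1 / p) := by
      rw [eLpNorm_eq_lintegral_rpow_enorm_toReal (by simpa using hp0) ENNReal.ofReal_ne_top,
        ENNReal.toReal_ofReal hp0.le]
      congr 1
      refine lintegral_congr fun x => ?_
      rw [← ofReal_norm, norm_dualTest hq1, ENNReal.ofReal_rpow_of_nonneg _ hp0.le]
      · congr 1
        simp only [hφ]
        split_ifs with h1
        · rw [← Real.rpow_mul (norm_nonneg _), hpq.symm.sub_one_mul_conj]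
        · exact Real.zero_rpow hp0.ne'
      · split_ifs <;> positivity
    rwa [h3, h4] at h1
  have hlim : Filter.Tendsto X Filter.atTop (nhds (∫⁻ x, ‖f x‖ₑ ^ q ∂ν)) := by
    refine lintegral_tendsto_of_tendsto_of_monotone
      (fun n => (hφm n).ennreal_ofReal.aemeasurable) (ae_of_all _ fun x n n' hn => ?_)
      (ae_of_all _ fun x => ?_)
    · refine ENNReal.ofReal_le_ofReal ?_
      simp only [hφ]
      split_ifs with h1 h2
      · exact le_rfl
      · exact absurd (h1.trans (by exact_mod_cast hn)) h2
      · positivity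
      · exact le_rfl
    · refine tendsto_const_nhds.congr' ?_
      obtain ⟨N, hN⟩ := exists_nat_ge (‖f x‖)
      filter_upwards [Filter.eventually_ge_atTop N] with n hn
      have : ‖f x‖ ≤ n := hN.trans (by exact_mod_cast hn)
      simp only [hφ, this, if_true]
      rw [← ofReal_norm, ENNReal.ofReal_rpow_of_nonneg (norm_nonneg _) hq0.le]
  rw [eLpNorm_eq_lintegral_rpow_enorm_toReal (by simpa using hq0) ENNReal.ofReal_ne_top,
    ENNReal.toReal_ofReal hq0.le]
  exact le_of_tendsto ((ENNReal.continuous_rpow_const.tendsto _).comp hlim)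
    (Filter.Eventually.of_forall hXC)

variable {p : ℝ≥0∞} [Fact (1 ≤ p)]

/-- The complex measure defined by a bounded functional on `L^p`. -/
noncomputable def complexMeasureOfDual (hp : p ≠ ∞) (T : StrongDual ℂ (Lp ℂ p ν)) :
    ComplexMeasure α := by
  classical exact
  { measureOf' := fun S => if hS : MeasurableSet S then
      T (indicatorConstLp p hS (measure_ne_top ν S) 1) else 0
    empty' := by
      rw [dif_pos MeasurableSet.empty, indicatorConstLp_empty, map_zero]
    not_measurable' := fun S hS => dif_neg hS
    m_iUnion' := fun S hS hdis => by
      have hfin : ∀ s : Finset ℕ, MeasurableSet (⋃ i ∈ s, S i) := fun s =>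
        s.measurableSet_biUnion fun i _ => hS i
      rw [dif_pos (MeasurableSet.iUnion hS)]
      have hsum : ∀ s : Finset ℕ, ∑ i ∈ s, (if h : MeasurableSet (S i) then
          T (indicatorConstLp p h (measure_ne_top ν (S i)) 1) else 0) =
          T (indicatorConstLp p (hfin s) (measure_ne_top ν _) 1) := by
        intro s
        induction s using Finset.induction_on with
        | empty =>
          simp only [Finset.sum_empty, Finset.notMem_empty, iUnion_of_empty, iUnion_empty,
            indicatorConstLp_empty, map_zero]
        | insert a s ha ih =>
          rw [Finset.sum_insert ha, ih, dif_pos (hS a), ← map_add,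
            ← indicatorConstLp_disjoint_union]
          · simp only [Finset.set_biUnion_insert]
          · rw [disjoint_iUnion₂_right]
            intro i hi
            exact hdis fun e => ha (e ▸ hi)
      rw [HasSum]
      simp only [hsum]
      -- Countable additivity: partial unions converge in measure, so their indicators converge in
      -- `L^p` because `p` is finite.
      refine (T.continuous.tendsto _).comp (tendsto_indicatorConstLp_set hp ?_)
      have hm := (tendsto_measure_biUnion_Ici_zero_of_pairwise_disjoint (μ := ν)
        (fun i => (hS i).nullMeasurableSet) hdis)
      rw [ENNReal.tendsto_nhds_zero] at hm ⊢
      intro ε hε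
      obtain ⟨N, hN⟩ := (hm ε hε).exists
      filter_upwards [Filter.eventually_ge_atTop (Finset.range N)] with s hs
      refine (measure_mono ?_).trans hN
      rintro x (⟨hx, hx'⟩ | ⟨hx, hx'⟩)
      · exact absurd (iUnion₂_subset (fun i _ => subset_iUnion S i) hx) hx'
      · obtain ⟨i, hi⟩ := mem_iUnion.1 hx
        refine mem_iUnion₂.2 ⟨i, ?_, hi⟩
        by_contra hlt
        refine hx' (mem_iUnion₂.2 ⟨i, hs (Finset.mem_range.2 ?_), hi⟩)
        simpa using hlt }

theorem complexMeasureOfDual_apply (hp : p ≠ ∞) (T : StrongDual ℂ (Lp ℂ p ν)) {S : Set α}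
    (hS : MeasurableSet S) : complexMeasureOfDual hp T S =
      T (indicatorConstLp p hS (measure_ne_top ν S) 1) := dif_pos hS

/-- The Radon-Nikodym theorem for complex measures. -/
theorem MeasureTheory.ComplexMeasure.setIntegral_rnDeriv {c : ComplexMeasure α}
    (hc : ∀ S, MeasurableSet S → ν S = 0 → c S = 0) {S : Set α} (hS : MeasurableSet S) :
    ∫ x in S, c.rnDeriv ν x ∂ν = c S := by
  have hre : ν.withDensityᵥ (ComplexMeasure.re c |>.rnDeriv ν) = ComplexMeasure.re c := by
    refine SignedMeasure.withDensityᵥ_rnDeriv_eq _ _ (VectorMeasure.AbsolutelyContinuous.mk ?_)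
    intro S hS h0
    rw [Measure.toENNRealVectorMeasure_apply_measurable hS] at h0
    change (c S).re = 0
    rw [hc S hS h0, Complex.zero_re]
  have him : ν.withDensityᵥ (ComplexMeasure.im c |>.rnDeriv ν) = ComplexMeasure.im c := by
    refine SignedMeasure.withDensityᵥ_rnDeriv_eq _ _ (VectorMeasure.AbsolutelyContinuous.mk ?_)
    intro S hS h0
    rw [Measure.toENNRealVectorMeasure_apply_measurable hS] at h0
    change (c S).im = 0
    rw [hc S hS h0, Complex.zero_im]
  apply Complex.ext
  · rw [← RCLike.re_eq_complex_re, ← integral_re (c.integrable_rnDeriv ν).integrableOn]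
    change ∫ x in S, (ComplexMeasure.re c).rnDeriv ν x ∂ν = (ComplexMeasure.re c) S
    conv_rhs => rw [← hre]
    rw [withDensityᵥ_apply (SignedMeasure.integrable_rnDeriv _ _) hS]
  · rw [← RCLike.im_eq_complex_im, ← integral_im (c.integrable_rnDeriv ν).integrableOn]
    change ∫ x in S, (ComplexMeasure.im c).rnDeriv ν x ∂ν = (ComplexMeasure.im c) S
    conv_rhs => rw [← him]
    rw [withDensityᵥ_apply (SignedMeasure.integrable_rnDeriv _ _) hS]

/-- A functional on `L^p` given by integration against `f` on indicators is so on every function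
for which the integral converges. -/
theorem dual_apply_eq_integral_of_indicator (hp : p ≠ ∞) {T : StrongDual ℂ (Lp ℂ p ν)}
    {f : α → ℂ} (hf : Integrable f ν)
    (hT : ∀ S (hS : MeasurableSet S),
      T (indicatorConstLp p hS (measure_ne_top ν S) 1) = ∫ x in S, f x ∂ν)
    (g : Lp ℂ p ν) (hfg : Integrable (fun x => f x * g x) ν) : T g = ∫ x, f x * g x ∂ν := by
  have hsimple : ∀ s : SimpleFunc α ℂ, ∀ hs : MemLp s p ν,
      T (hs.toLp s) = ∫ x, f x * s x ∂ν := by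
    intro s
    induction s using SimpleFunc.induction with
    | const c hS =>
      rename_i S
      intro hs
      have h1 : hs.toLp _ = c • indicatorConstLp p hS (measure_ne_top ν S) (1 : ℂ) := by
        rw [indicatorConstLp, ← MemLp.toLp_const_smul]
        refine MemLp.toLp_congr _ _ (ae_of_all _ fun x => ?_)
        by_cases hx : x ∈ S <;> simp [hx]
      rw [h1, map_smul, hT, ← integral_indicator hS, smul_eq_mul, ← integral_const_mul]
      refine integral_congr_ae (ae_of_all _ fun x => ?_)
      by_cases hx : x ∈ S <;> simp [hx, mul_comm]
    | add hst ihs iht =>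
      rename_i s t
      intro h
      have hs : MemLp s p ν := SimpleFunc.memLp_of_isFiniteMeasure s p ν
      have ht : MemLp t p ν := SimpleFunc.memLp_of_isFiniteMeasure t p ν
      have h1 : h.toLp _ = hs.toLp _ + ht.toLp _ := (MemLp.toLp_add hs ht).symm
      have hi : ∀ s : SimpleFunc α ℂ, Integrable (fun x => f x * s x) ν := fun s => by
        obtain ⟨C, hC⟩ := s.exists_forall_norm_le
        exact hf.mul_bdd s.aestronglyMeasurable (ae_of_all _ hC)
      rw [h1, map_add, ihs, iht, ← integral_add (hi s) (hi t)]
      refine integral_congr_ae (ae_of_all _ fun x => ?_)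
      simp [mul_add]
  have hgm : Measurable g := (Lp.stronglyMeasurable g).measurable
  have hgp : MemLp g p ν := Lp.memLp g
  set s : ℕ → SimpleFunc α ℂ := SimpleFunc.approxOn g hgm (range g ∪ {0}) 0 (by simp)
  have hs : ∀ n, MemLp (s n) p ν := SimpleFunc.memLp_approxOn_range hgm hgp
  have h1 : Filter.Tendsto (fun n => T ((hs n).toLp (s n))) Filter.atTop (nhds (T g)) := by
    have := SimpleFunc.tendsto_approxOn_range_Lp hp hgm hgp
    rw [Lp.toLp_coeFn] at this
    exact (T.continuous.tendsto _).comp this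
  -- The approximants satisfy `‖s n‖ ≤ 2 ‖g‖`, so integrability of `f g` alone gives domination; `f`
  -- need not yet be known to lie in the dual space.
  have h2 : Filter.Tendsto (fun n => ∫ x, f x * s n x ∂ν) Filter.atTop
      (nhds (∫ x, f x * g x ∂ν)) := by
    refine tendsto_integral_of_dominated_convergence (fun x => 2 * ‖f x * g x‖)
      (fun n => hf.1.mul (s n).aestronglyMeasurable) (hfg.norm.const_mul 2)
      (fun n => ae_of_all _ fun x => ?_) (ae_of_all _ fun x => ?_)
    · rw [norm_mul, norm_mul]
      have := SimpleFunc.norm_approxOn_zero_le hgm (s := range g ∪ {0}) (by simp) x n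
      have h3 : ‖s n x‖ ≤ ‖g x‖ + ‖g x‖ := this
      nlinarith [norm_nonneg (f x)]
    · exact (SimpleFunc.tendsto_approxOn hgm _ (subset_closure (by simp))).const_mul _
  simp only [hsimple] at h1
  exact tendsto_nhds_unique h1 h2

/-- The Riesz representation of bounded functionals on `L^p` of a finite measure. -/
theorem exists_memLp_forall_dual_eq_integral {p q : ℝ} (hpq : p.HolderConjugate q)
    [Fact (1 ≤ ENNReal.ofReal p)] (T : StrongDual ℂ (Lp ℂ (ENNReal.ofReal p) ν)) :
    ∃ f : α → ℂ, MemLp f (ENNReal.ofReal q) ν ∧ ∀ g : Lp ℂ (ENNReal.ofReal p) ν,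
      T g = ∫ x, f x * g x ∂ν := by
  have hp : ENNReal.ofReal p ≠ ∞ := ENNReal.ofReal_ne_top
  set c := complexMeasureOfDual hp T
  have hc : ∀ S, MeasurableSet S → ν S = 0 → c S = 0 := by
    intro S hS h0
    have : indicatorConstLp (ENNReal.ofReal p) hS (measure_ne_top ν S) (1 : ℂ) = 0 := by
      rw [← norm_eq_zero, norm_indicatorConstLp (by simpa using hpq.pos) hp, Measure.real, h0]
      simp [hpq.pos.ne', hpq.pos.le]
    rw [complexMeasureOfDual_apply hp T hS, this, map_zero]
  set f := c.rnDeriv ν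
  have hf : Integrable f ν := c.integrable_rnDeriv ν
  have key := dual_apply_eq_integral_of_indicator hp (T := T) hf fun S hS => by
    rw [ComplexMeasure.setIntegral_rnDeriv hc hS, complexMeasureOfDual_apply hp T hS]
  -- The representation is used twice: for bounded `g`, where integrability of `f` suffices, to
  -- obtain `f ∈ L^q`; afterwards, by Hölder, for every `g` in `L^p`.
  have hle : eLpNorm f (ENNReal.ofReal q) ν ≤ ‖T‖ₑ := by
    refine eLpNorm_le_of_forall_bounded hpq hf.1 fun g hg ⟨K, hK⟩ => ?_
    have hgp : MemLp g (ENNReal.ofReal p) ν :=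
      MemLp.of_bound hg.aestronglyMeasurable K (ae_of_all _ hK)
    have hae : (fun x => f x * hgp.toLp g x) =ᵐ[ν] fun x => f x * g x :=
      hgp.coeFn_toLp.mono fun x hx => by simp only [hx]
    have h1 := key (hgp.toLp g)
      ((hf.mul_bdd hg.aestronglyMeasurable (ae_of_all _ hK)).congr hae.symm)
    rw [integral_congr_ae hae] at h1
    rw [← h1, ← Lp.enorm_toLp (hf := hgp)]
    exact T.le_opENorm _
  have hfq : MemLp f (ENNReal.ofReal q) ν := ⟨hf.1, hle.trans_lt enorm_lt_top⟩
  refine ⟨f, hfq, fun g => key g ?_⟩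
  have : ENNReal.HolderConjugate (ENNReal.ofReal q) (ENNReal.ofReal p) := hpq.symm.ennrealOfReal
  exact hfq.integrable_mul (Lp.memLp g)

end LpDuality

/-! ### Nonexpansive truncation of complex values. -/

section Truncation

/-- Truncation of the real and imaginary parts at height `n`. -/
noncomputable def truncate (n : ℕ) (z : ℂ) : ℂ :=
  ⟨max (-n) (min n z.re), max (-n) (min n z.im)⟩

theorem Complex.norm_le_norm_of_abs_le {z w : ℂ} (h1 : |z.re| ≤ |w.re|) (h2 : |z.im| ≤ |w.im|) :
    ‖z‖ ≤ ‖w‖ := by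
  rw [Complex.norm_eq_sqrt_sq_add_sq, Complex.norm_eq_sqrt_sq_add_sq]
  exact Real.sqrt_le_sqrt (add_le_add (sq_le_sq.2 h1) (sq_le_sq.2 h2))

theorem abs_clamp_sub_le (c s t : ℝ) :
    |max (-c) (min c s) - max (-c) (min c t)| ≤ |s - t| := by
  refine (abs_max_sub_max_le_max _ _ _ _).trans (max_le (by simp) ?_)
  exact (abs_min_sub_min_le_max _ _ _ _).trans (max_le (by simp) le_rfl)

/-- Clamping is nonexpansive in each coordinate. Truncation thus does not increase the distance of
`f` to a constant, provided the constant is truncated as well. -/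
theorem norm_truncate_sub_le (n : ℕ) (z w : ℂ) : ‖truncate n z - truncate n w‖ ≤ ‖z - w‖ :=
  Complex.norm_le_norm_of_abs_le (abs_clamp_sub_le n z.re w.re) (abs_clamp_sub_le n z.im w.im)

theorem truncate_zero (n : ℕ) : truncate n 0 = 0 := by
  apply Complex.ext <;> simp [truncate]

theorem norm_truncate_le_norm (n : ℕ) (z : ℂ) : ‖truncate n z‖ ≤ ‖z‖ := by
  simpa [truncate_zero] using norm_truncate_sub_le n z 0

theorem norm_truncate_le (n : ℕ) (z : ℂ) : ‖truncate n z‖ ≤ 2 * n := by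
  have key : ∀ t : ℝ, |max (-(n : ℝ)) (min n t)| ≤ n := fun t =>
    abs_le.2 ⟨le_max_left _ _, max_le (by linarith [n.cast_nonneg (α := ℝ)]) (min_le_left _ _)⟩
  have := Complex.norm_le_abs_re_add_abs_im (truncate n z)
  have h1 : |(truncate n z).re| ≤ n := key _
  have h2 : |(truncate n z).im| ≤ n := key _
  linarith

theorem truncate_eq_self {n : ℕ} {z : ℂ} (h : ‖z‖ ≤ n) : truncate n z = z := by
  have h1 := abs_le.1 ((Complex.abs_re_le_norm z).trans h)
  have h2 := abs_le.1 ((Complex.abs_im_le_norm z).trans h)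
  apply Complex.ext
  · simp [truncate, h1.1, h1.2]
  · simp [truncate, h2.1, h2.2]

theorem tendsto_truncate (z : ℂ) :
    Filter.Tendsto (fun n => truncate n z) Filter.atTop (nhds z) := by
  refine tendsto_const_nhds.congr' ?_
  obtain ⟨N, hN⟩ := exists_nat_ge ‖z‖
  filter_upwards [Filter.eventually_ge_atTop N] with n hn
  exact (truncate_eq_self (hN.trans (by exact_mod_cast hn))).symm

theorem continuous_truncate (n : ℕ) : Continuous (truncate n) := by
  refine (LipschitzWith.of_dist_le' (K := 1) fun z w => ?_).continuous
  rw [dist_eq_norm, dist_eq_norm, one_mul]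
  exact norm_truncate_sub_le n z w

end Truncation

/-! ### Normalised Hölder inequality and finite covers. -/

section Averages

variable {α : Type*} [MeasurableSpace α]

theorem rpow_inv_mul_lintegral_eq (ν : Measure α) (V : ℝ≥0∞) {p : ℝ} (hp : 0 < p) (h : α → ℂ) :
    (V⁻¹ * ∫⁻ y, ‖h y‖ₑ ^ p ∂ν) ^ (1 / p) =
      (V⁻¹) ^ (1 / p) * eLpNorm h (ENNReal.ofReal p) ν := by
  rw [eLpNorm_eq_lintegral_rpow_enorm_toReal (by simpa using hp) ENNReal.ofReal_ne_top,
    ENNReal.toReal_ofReal hp.le, ENNReal.mul_rpow_of_nonneg _ _ (by positivity)]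

/-- Hölder's inequality for normalised integrals. -/
theorem lintegral_mul_le_of_average_le {ν : Measure α} {V : ℝ≥0∞} (hV0 : V ≠ 0) (hV : V ≠ ∞)
    {p q : ℝ} (hpq : p.HolderConjugate q) {a g : α → ℂ} (ha : AEStronglyMeasurable a ν)
    (hg : AEStronglyMeasurable g ν)
    (h : (V⁻¹ * ∫⁻ y, ‖a y‖ₑ ^ p ∂ν) ^ (1 / p) ≤ V⁻¹) :
    ∫⁻ y, ‖g y‖ₑ * ‖a y‖ₑ ∂ν ≤ (V⁻¹ * ∫⁻ y, ‖g y‖ₑ ^ q ∂ν) ^ (1 / q) := by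
  have hp : 0 ≤ 1 / p := one_div_nonneg.2 hpq.pos.le
  have hq : 0 ≤ 1 / q := one_div_nonneg.2 hpq.symm.pos.le
  have hVV : V ^ (1 / q) * V ^ (1 / p) = V := by
    rw [← ENNReal.rpow_add _ _ hV0 hV, one_div, one_div, add_comm, hpq.inv_add_inv_eq_one,
      ENNReal.rpow_one]
  -- Normalising both factors produces `V ^ (1 / q) * V ^ (1 / p) = V`, which cancels the bound
  -- `V⁻¹` on `a`.
  have key : ∀ X : ℝ≥0∞, ∀ e : ℝ, 0 ≤ e → X ^ e = V ^ e * (V⁻¹ * X) ^ e := fun X e he => by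
    rw [← ENNReal.mul_rpow_of_nonneg _ _ he, ← mul_assoc, ENNReal.mul_inv_cancel hV0 hV, one_mul]
  calc ∫⁻ y, ‖g y‖ₑ * ‖a y‖ₑ ∂ν
      ≤ (∫⁻ y, ‖g y‖ₑ ^ q ∂ν) ^ (1 / q) * (∫⁻ y, ‖a y‖ₑ ^ p ∂ν) ^ (1 / p) :=
        ENNReal.lintegral_mul_le_Lp_mul_Lq ν hpq.symm hg.enorm ha.enorm
    _ = V ^ (1 / q) * V ^ (1 / p) * ((V⁻¹ * ∫⁻ y, ‖g y‖ₑ ^ q ∂ν) ^ (1 / q) *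
        (V⁻¹ * ∫⁻ y, ‖a y‖ₑ ^ p ∂ν) ^ (1 / p)) := by
        rw [key _ _ hq, key (∫⁻ y, ‖a y‖ₑ ^ p ∂ν) _ hp]; ring
    _ ≤ V * ((V⁻¹ * ∫⁻ y, ‖g y‖ₑ ^ q ∂ν) ^ (1 / q) * V⁻¹) := by rw [hVV]; gcongr
    _ = _ := by
        rw [mul_comm _ V⁻¹, ← mul_assoc, ENNReal.mul_inv_cancel hV0 hV, one_mul]

theorem memLp_restrict_of_subset_biUnion {ι : Type*} {μ : Measure α} {q : ℝ} (hq : 0 < q)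
    {f : α → ℂ} (hf : AEStronglyMeasurable f μ) {I : Set ι} (hI : I.Finite) {S : ι → Set α}
    {B : Set α} (h : ∀ i ∈ I, MemLp f (ENNReal.ofReal q) (μ.restrict (S i)))
    (hB : B ⊆ ⋃ i ∈ I, S i) : MemLp f (ENNReal.ofReal q) (μ.restrict B) := by
  have hiff : ∀ S : Set α, MemLp f (ENNReal.ofReal q) (μ.restrict S) ↔
      IntegrableOn (fun x => ‖f x‖ ^ (ENNReal.ofReal q).toReal) S μ := fun S =>
    (integrable_norm_rpow_iff hf.restrict (by simpa using hq) ENNReal.ofReal_ne_top).symm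
  rw [hiff]
  exact IntegrableOn.mono_set ((integrableOn_finite_biUnion hI).2 fun i hi =>
    (hiff _).1 (h i hi)) hB

end Averages

/-! ### Truncated pairings as continuous functionals on `L¹`. -/

section Pairing

variable {α : Type*} [MeasurableSpace α] {μ : Measure α}

/-- Integration against a bounded function, as a functional on `L¹`. -/
noncomputable def boundedPairing (φ : α → ℂ) (hφ : AEStronglyMeasurable φ μ) (K : ℝ)
    (hK : ∀ x, ‖φ x‖ ≤ K) : Lp ℂ 1 μ →L[ℂ] ℂ :=
  LinearMap.mkContinuous
    { toFun := fun g => ∫ x, φ x * g x ∂μ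
      map_add' := fun g h => by
        have hi : ∀ g : Lp ℂ 1 μ, Integrable (fun x => φ x * g x) μ := fun g =>
          (L1.integrable_coeFn g).bdd_mul hφ (ae_of_all _ hK)
        rw [← integral_add (hi g) (hi h)]
        refine integral_congr_ae ?_
        filter_upwards [Lp.coeFn_add g h] with x hx
        rw [hx, Pi.add_apply, mul_add]
      map_smul' := fun c g => by
        rw [RingHom.id_apply, smul_eq_mul, ← integral_const_mul]
        refine integral_congr_ae ?_
        filter_upwards [Lp.coeFn_smul c g] with x hx
        rw [hx, Pi.smul_apply, smul_eq_mul]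
        ring } K fun g => by
      rw [L1.norm_eq_integral_norm, ← integral_const_mul]
      refine norm_integral_le_of_norm_le ((L1.integrable_coeFn g).norm.const_mul K)
        (ae_of_all _ fun x => ?_)
      rw [norm_mul]
      gcongr
      exact hK x

/-- The pairing of `g` with the truncations of `f`. -/
noncomputable def truncatedPairing {f : α → ℂ} (hf : AEStronglyMeasurable f μ) (n : ℕ) :
    Lp ℂ 1 μ →L[ℂ] ℂ :=
  boundedPairing (fun x => truncate n (f x)) ((continuous_truncate n).comp_aestronglyMeasurable hf)
    (2 * n) fun x => norm_truncate_le n (f x)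

theorem truncatedPairing_apply {f : α → ℂ} (hf : AEStronglyMeasurable f μ) (n : ℕ)
    (g : Lp ℂ 1 μ) : truncatedPairing hf n g = ∫ x, truncate n (f x) * g x ∂μ := rfl

theorem tendsto_truncatedPairing {f : α → ℂ} (hf : AEStronglyMeasurable f μ) {g : Lp ℂ 1 μ}
    (hfg : Integrable (fun x => f x * g x) μ) :
    Filter.Tendsto (fun n => truncatedPairing hf n g) Filter.atTop
      (nhds (∫ x, f x * g x ∂μ)) := by
  refine tendsto_integral_of_dominated_convergence (fun x => ‖f x * g x‖)
    (fun n => ((continuous_truncate n).comp_aestronglyMeasurable hf).mul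
      (Lp.aestronglyMeasurable g)) hfg.norm (fun n => ae_of_all _ fun x => ?_)
    (ae_of_all _ fun x => (tendsto_truncate (f x)).mul_const _)
  rw [norm_mul, norm_mul]
  gcongr
  exact norm_truncate_le_norm n (f x)

end Pairing

/-! ### From BMO functions to functionals on the Hardy space. -/

section AtomPairing

variable {M : Type*} [MetricSpace M] [MeasurableSpace M] [BorelSpace M]
  {μ : Measure M} [IsFiniteMeasure μ]

omit [BorelSpace M] in
theorem IsStandardAtomOn.memLp {r : ℝ} (hr : 0 < r) {x : M} {ρ : ℝ} {a : Lp ℂ 1 μ}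
    (hB : μ (ball x ρ) ≠ 0) (ha : IsStandardAtomOn μ r x ρ a) :
    MemLp a (ENNReal.ofReal r) (μ.restrict (ball x ρ)) := by
  refine ⟨(Lp.aestronglyMeasurable a).restrict, ?_⟩
  have h := ha.2.1
  rw [rpow_inv_mul_lintegral_eq _ _ hr] at h
  have h1 : eLpNorm a (ENNReal.ofReal r) (μ.restrict (ball x ρ)) ≠ ∞ := by
    intro htop
    rw [htop, ENNReal.mul_top] at h
    · exact ENNReal.inv_ne_top.2 hB (top_le_iff.1 h)
    · have : (μ (ball x ρ))⁻¹ ≠ 0 := ENNReal.inv_ne_zero.2 (measure_ne_top _ _)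
      simp [this, hB]
  exact h1.lt_top

omit [BorelSpace M] [IsFiniteMeasure μ] in
theorem IsStandardAtomOn.integral_eq_zero {r : ℝ} {x : M} {ρ : ℝ} {a : Lp ℂ 1 μ}
    (ha : IsStandardAtomOn μ r x ρ a) : ∫ y, a y ∂μ = 0 := by
  rw [← ha.2.2]
  exact (setIntegral_eq_integral_of_ae_compl_eq_zero ha.1).symm

/-- Functions in `L^q` on small balls are in `L^q` on all balls. -/
theorem LocallyDoubling.memLp_restrict_ball (hLD : LocallyDoubling μ) (hμ : μ ≠ 0) {s : ℝ}
    (hs : 0 < s) {q : ℝ} (hq : 0 < q) {f : M → ℂ} (hf : AEStronglyMeasurable f μ)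
    (h : ∀ x, MemLp f (ENNReal.ofReal q) (μ.restrict (ball x s))) (x : M) (R : ℝ) :
    MemLp f (ENNReal.ofReal q) (μ.restrict (ball x R)) := by
  obtain ⟨Z, -, hcov, -, hfin⟩ := hLD.exists_net hμ hs
  refine memLp_restrict_of_subset_biUnion hq hf (hfin x (R + s)) (S := fun z => ball z s)
    (fun z _ => h z) fun y hy => ?_
  obtain ⟨z, hz, hyz⟩ := hcov y
  refine mem_iUnion₂.2 ⟨z, ⟨hz, ?_⟩, hyz⟩
  have := dist_triangle z y x
  rw [mem_ball] at hy
  rw [dist_comm z y] at this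
  linarith

omit [BorelSpace M] in
theorem IsStandardAtomOn.integrable_mul {r q : ℝ} (hpq : r.HolderConjugate q) {x : M} {ρ : ℝ}
    {a : Lp ℂ 1 μ} (hB : μ (ball x ρ) ≠ 0) (ha : IsStandardAtomOn μ r x ρ a) {f : M → ℂ}
    (hf : MemLp f (ENNReal.ofReal q) (μ.restrict (ball x ρ))) :
    Integrable (fun y => f y * a y) μ := by
  have : ENNReal.HolderConjugate (ENNReal.ofReal q) (ENNReal.ofReal r) := hpq.symm.ennrealOfReal
  have h1 : IntegrableOn (fun y => f y * a y) (ball x ρ) μ :=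
    hf.integrable_mul (ha.memLp hpq.pos hB)
  exact h1.integrable_of_ae_notMem_eq_zero (ha.1.mono fun y hy hyB => by rw [hy hyB, mul_zero])

omit [MetricSpace M] [BorelSpace M] [IsFiniteMeasure μ] in
theorem IsExceptionalAtom.integrable_mul {a : Lp ℂ 1 μ} (ha : IsExceptionalAtom μ a) {f : M → ℂ}
    (hf : Integrable f μ) : Integrable (fun y => f y * a y) μ :=
  (hf.mul_const (((μ.real univ)⁻¹ : ℝ) : ℂ)).congr (ha.mono fun y hy => by simp only [hy])

omit [BorelSpace M] in
/-- Functions that are integrable and locally in `L^q` pair with finite atomic functions. -/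
theorem integrable_mul_of_mem_finiteAtomic (hLD : LocallyDoubling μ) (hμ : μ ≠ 0) {r q : ℝ}
    (hpq : r.HolderConjugate q) {f : M → ℂ} (hf : Integrable f μ)
    (hfq : ∀ x R, MemLp f (ENNReal.ofReal q) (μ.restrict (ball x R)))
    {g : Lp ℂ 1 μ} (hg : g ∈ finiteAtomic μ r) : Integrable (fun y => f y * g y) μ := by
  induction hg using Submodule.span_induction with
  | mem a ha =>
    rcases ha with ⟨x, ρ, hρ, ha⟩ | ha
    · exact ha.integrable_mul hpq (hLD.measure_ball_pos hμ x hρ).ne' (hfq x ρ)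
    · exact ha.integrable_mul hf
  | zero =>
    refine (integrable_zero M ℂ μ).congr ?_
    filter_upwards [Lp.coeFn_zero ℂ 1 μ] with x hx
    rw [hx, Pi.zero_apply, mul_zero]
  | add g h _ _ ihg ihh =>
    refine (ihg.add ihh).congr ?_
    filter_upwards [Lp.coeFn_add g h] with x hx
    rw [Pi.add_apply, hx, Pi.add_apply, mul_add]
  | smul c g _ ih =>
    refine (ih.const_mul c).congr ?_
    filter_upwards [Lp.coeFn_smul c g] with x hx
    rw [hx, Pi.smul_apply, smul_eq_mul]
    ring

omit [BorelSpace M] [IsFiniteMeasure μ] in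
theorem average_le_meanOscillation {q b : ℝ} (f : M → ℂ) {x : M} {ρ : ℝ} (hρ : 0 < ρ)
    (hρb : ρ ≤ b) :
    ((μ (ball x ρ))⁻¹ * ∫⁻ y in ball x ρ, ‖f y - ⨍ w in ball x ρ, f w ∂μ‖ₑ ^ q ∂μ) ^ (1 / q) ≤
      meanOscillation μ q b f :=
  le_iSup_of_le x (le_iSup_of_le ρ (le_iSup_of_le hρ (le_iSup_of_le hρb le_rfl)))

/-- Finite oscillation on balls of radius `b` puts `f` minus its mean in `L^q` there; restoring the
mean and covering by finitely many such balls handles any radius. This makes atoms on large balls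
admissible in the pairing. -/
theorem MemBMO.memLp_restrict_ball (hLD : LocallyDoubling μ) (hμ : μ ≠ 0) {q b : ℝ} (hq : 0 < q)
    (hb : 0 < b) {f : M → ℂ} (hf : MemBMO μ q b f) (x : M) (R : ℝ) :
    MemLp f (ENNReal.ofReal q) (μ.restrict (ball x R)) := by
  refine hLD.memLp_restrict_ball hμ hb hq hf.1.1 (fun x => ?_) x R
  have hB := hLD.measure_ball_pos hμ x hb
  have h1 := (average_le_meanOscillation (μ := μ) (q := q) f (x := x) hb le_rfl).trans_lt hf.2
  rw [rpow_inv_mul_lintegral_eq _ _ hq (fun y => f y - ⨍ w in ball x b, f w ∂μ)] at h1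
  have h2 : MemLp (fun y => f y - ⨍ w in ball x b, f w ∂μ) (ENNReal.ofReal q)
      (μ.restrict (ball x b)) := by
    refine ⟨hf.1.1.restrict.sub aestronglyMeasurable_const, ?_⟩
    refine lt_top_iff_ne_top.2 fun htop => ?_
    rw [htop, ENNReal.mul_top] at h1
    · exact h1.ne rfl
    · have : (μ (ball x b))⁻¹ ≠ 0 := ENNReal.inv_ne_zero.2 (measure_ne_top _ _)
      simp [this, hB.ne']
  refine (memLp_congr_ae (ae_of_all _ fun y => ?_)).1
    (h2.add (memLp_const (⨍ w in ball x b, f w ∂μ)))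
  exact sub_add_cancel (f y) _

omit [BorelSpace M] in
/-- The pairing of an atom with the truncations of `f` is bounded by the oscillation of `f`. -/
theorem IsStandardAtomOn.norm_truncatedPairing_le {r q : ℝ} (hpq : r.HolderConjugate q) {b : ℝ}
    {x : M} {ρ : ℝ} (hρ : 0 < ρ) (hρb : ρ ≤ b) {a : Lp ℂ 1 μ} (hB : μ (ball x ρ) ≠ 0)
    (ha : IsStandardAtomOn μ r x ρ a) {f : M → ℂ} (hf : MemBMO μ q b f) (n : ℕ) :
    ‖truncatedPairing hf.1.1 n a‖ ≤ (meanOscillation μ q b f).toReal := by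
  set m := ⨍ w in ball x ρ, f w ∂μ
  have hfm : AEStronglyMeasurable f μ := hf.1.1
  have hai : Integrable a μ := L1.integrable_coeFn a
  -- The atom has mean zero, so any constant may be subtracted. The truncated mean `T_n m`, rather
  -- than the mean of `T_n f`, allows the Lipschitz bound to be applied directly.
  have h1 : truncatedPairing hf.1.1 n a = ∫ y, (truncate n (f y) - truncate n m) * a y ∂μ := by
    have h2 : Integrable (fun y => truncate n (f y) * a y) μ :=
      hai.bdd_mul ((continuous_truncate n).comp_aestronglyMeasurable hfm)
        (ae_of_all _ fun y => norm_truncate_le n (f y))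
    simp only [sub_mul]
    rw [integral_sub h2 (hai.const_mul _), integral_const_mul, ha.integral_eq_zero, mul_zero,
      sub_zero, truncatedPairing_apply]
  rw [h1, ← ENNReal.ofReal_le_iff_le_toReal hf.2.ne, ofReal_norm]
  calc ‖∫ y, (truncate n (f y) - truncate n m) * a y ∂μ‖ₑ
      = ‖∫ y in ball x ρ, (truncate n (f y) - truncate n m) * a y ∂μ‖ₑ := by
        rw [setIntegral_eq_integral_of_ae_compl_eq_zero]
        exact ha.1.mono fun y hy hyB => by rw [hy hyB, mul_zero]
    _ ≤ ∫⁻ y in ball x ρ, ‖(truncate n (f y) - truncate n m) * a y‖ₑ ∂μ :=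
        enorm_integral_le_lintegral_enorm _
    _ ≤ ∫⁻ y in ball x ρ, ‖f y - m‖ₑ * ‖a y‖ₑ ∂μ := by
        refine lintegral_mono fun y => ?_
        rw [enorm_mul]
        gcongr
        exact enorm_le_iff_norm_le.2 (norm_truncate_sub_le n (f y) m)
    _ ≤ _ := lintegral_mul_le_of_average_le hB (measure_ne_top _ _) hpq
        (Lp.aestronglyMeasurable a).restrict (hfm.restrict.sub aestronglyMeasurable_const) ha.2.1
    _ ≤ _ := average_le_meanOscillation f hρ hρb

omit [MetricSpace M] [BorelSpace M] [IsFiniteMeasure μ] in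
theorem IsExceptionalAtom.norm_truncatedPairing_le {a : Lp ℂ 1 μ} (ha : IsExceptionalAtom μ a)
    {f : M → ℂ} (hf : Integrable f μ) (n : ℕ) :
    ‖truncatedPairing hf.1 n a‖ ≤ (μ.real univ)⁻¹ * ∫ y, ‖f y‖ ∂μ := by
  rw [truncatedPairing_apply, ← integral_const_mul]
  refine norm_integral_le_of_norm_le (hf.norm.const_mul _) (ha.mono fun y hy => ?_)
  rw [hy, norm_mul, Complex.norm_real, Real.norm_of_nonneg (by positivity), mul_comm]
  gcongr
  exact norm_truncate_le_norm n (f y)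

omit [BorelSpace M] in
-- Standard atoms cost the oscillation, the exceptional atom costs the `L¹` norm divided by `μ(M)`;
-- the maximum covers both cases.
theorem IsAtomAtScale.norm_truncatedPairing_le (hLD : LocallyDoubling μ) (hμ : μ ≠ 0) {r q : ℝ}
    (hpq : r.HolderConjugate q) {b : ℝ} {a : Lp ℂ 1 μ} (ha : IsAtomAtScale μ r b a) {f : M → ℂ}
    (hf : MemBMO μ q b f) (n : ℕ) :
    ‖truncatedPairing hf.1.1 n a‖ ≤ max 1 (μ.real univ)⁻¹ * bmoNorm μ q b f := by
  have h1 : 0 ≤ ∫ y, ‖f y‖ ∂μ := integral_nonneg fun _ => norm_nonneg _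
  have h2 : 0 ≤ (meanOscillation μ q b f).toReal := ENNReal.toReal_nonneg
  have h3 : 0 ≤ bmoNorm μ q b f := add_nonneg h1 h2
  rcases ha with ⟨x, ρ, hρ, hρb, ha⟩ | ha
  · calc _ ≤ (meanOscillation μ q b f).toReal :=
          ha.norm_truncatedPairing_le hpq hρ hρb (hLD.measure_ball_pos hμ x hρ).ne' hf n
      _ ≤ 1 * bmoNorm μ q b f := by rw [bmoNorm]; linarith
      _ ≤ _ := by gcongr; exact le_max_left _ _
  · calc _ ≤ (μ.real univ)⁻¹ * ∫ y, ‖f y‖ ∂μ := ha.norm_truncatedPairing_le hf.1 n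
      _ ≤ max 1 (μ.real univ)⁻¹ * bmoNorm μ q b f := by
          gcongr
          · exact le_max_right _ _
          · rw [bmoNorm]; linarith

omit [BorelSpace M] in
theorem IsAtomAtScale.integrable_mul (hLD : LocallyDoubling μ) (hμ : μ ≠ 0) {r q : ℝ}
    (hpq : r.HolderConjugate q) {b : ℝ} {a : Lp ℂ 1 μ} (ha : IsAtomAtScale μ r b a) {f : M → ℂ}
    (hf : Integrable f μ) (hfq : ∀ x R, MemLp f (ENNReal.ofReal q) (μ.restrict (ball x R))) :
    Integrable (fun y => f y * a y) μ := by
  refine integrable_mul_of_mem_finiteAtomic hLD hμ hpq hf hfq (Submodule.subset_span ?_)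
  rcases ha with ⟨x, ρ, hρ, -, ha⟩ | ha
  · exact Or.inl ⟨x, ρ, hρ, ha⟩
  · exact Or.inr ha

omit [BorelSpace M] in
theorem HardySpace.le_mul_norm {r b : ℝ} {g : HardySpace μ r b} {K X : ℝ} (hK : 0 ≤ K)
    (h : ∀ t ∈ atomicCosts μ r b (toL1 μ r b g), X ≤ K * t) : X ≤ K * ‖g‖ := by
  have := (costs_nonempty μ r b g).to_subtype
  rw [norm_def, sInf_eq_iInf', Real.mul_iInf_of_nonneg hK]
  exact le_ciInf fun t => h t t.2

/-- A function in `BMO` defines a bounded functional on the Hardy space. -/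
theorem exists_dual_of_memBMO (hLD : LocallyDoubling μ) (hμ : μ ≠ 0) {r q : ℝ}
    (hpq : r.HolderConjugate q) {b : ℝ} (hb : 0 < b) {f : M → ℂ} (hf : MemBMO μ q b f) :
    ∃ l : StrongDual ℂ (HardySpace μ r b),
      (∀ g : HardySpace μ r b, HardySpace.toL1 μ r b g ∈ finiteAtomic μ r →
        Integrable (fun x => f x * HardySpace.toL1 μ r b g x) μ ∧
        l g = ∫ x, f x * HardySpace.toL1 μ r b g x ∂μ) ∧
      ‖l‖ ≤ max 1 (μ.real univ)⁻¹ * bmoNorm μ q b f := by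
  set K := max 1 (μ.real univ)⁻¹ * bmoNorm μ q b f
  have hK : 0 ≤ K := mul_nonneg (zero_le_one.trans (le_max_left _ _))
    (add_nonneg (integral_nonneg fun _ => norm_nonneg _) ENNReal.toReal_nonneg)
  have hfq := hf.memLp_restrict_ball hLD hμ hpq.symm.pos hb
  set Φ : ℕ → Lp ℂ 1 μ →L[ℂ] ℂ := truncatedPairing hf.1.1
  have hsum : ∀ {g : Lp ℂ 1 μ} {c a}, IsAtomicDecomposition μ r b g c a → ∀ n,
      HasSum (fun k => c k * Φ n (a k)) (Φ n g) := fun h n => by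
    simpa using h.2.2.mapL (Φ n)
  have hbd : ∀ {g : Lp ℂ 1 μ} {c a}, IsAtomicDecomposition μ r b g c a → ∀ n k,
      ‖c k * Φ n (a k)‖ ≤ ‖c k‖ * K := fun h n k => by
    rw [norm_mul]
    gcongr
    exact (h.1 k).norm_truncatedPairing_le hLD hμ hpq hf n
  have hle : ∀ (g : Lp ℂ 1 μ), ∀ t ∈ atomicCosts μ r b g, ∀ n, ‖Φ n g‖ ≤ K * t := by
    rintro g t ⟨c, a, h, rfl⟩ n
    rw [← (hsum h n).tsum_eq, mul_comm, ← tsum_mul_right]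
    exact tsum_of_norm_bounded (h.2.1.mul_right K).hasSum (hbd h n)
  -- A decomposition serves only to prove convergence, by dominated convergence for series; the
  -- sequence itself does not mention it, so the limit depends on `g` alone and is linear.
  have hlim : ∀ g : HardySpace μ r b, ∃ L, Filter.Tendsto
      (fun n => Φ n (HardySpace.toL1 μ r b g)) Filter.atTop (nhds L) := by
    intro g
    obtain ⟨t, c, a, h, rfl⟩ := HardySpace.costs_nonempty μ r b g
    refine ⟨∑' k, c k * ∫ x, f x * a k x ∂μ, ?_⟩
    simp only [← (hsum h _).tsum_eq]
    exact tendsto_tsum_of_dominated_convergence (h.2.1.mul_right K)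
      (fun k => (tendsto_truncatedPairing hf.1.1
        ((h.1 k).integrable_mul hLD hμ hpq hf.1 hfq)).const_mul _)
      (Filter.Eventually.of_forall fun n k => hbd h n k)
  choose L hL using hlim
  refine ⟨LinearMap.mkContinuous
    { toFun := L
      map_add' := fun g h => tendsto_nhds_unique (hL _) (by simpa using (hL g).add (hL h))
      map_smul' := fun z g => tendsto_nhds_unique (hL _) (by simpa using (hL g).const_mul z) } K
    fun g => HardySpace.le_mul_norm hK fun t ht => ?_, fun g hg => ?_,
    LinearMap.mkContinuous_norm_le _ hK _⟩
  · exact le_of_tendsto (hL g).norm (Filter.Eventually.of_forall fun n => hle _ t ht n)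
  · have hi := integrable_mul_of_mem_finiteAtomic hLD hμ hpq hf.1 hfq hg
    exact ⟨hi, tendsto_nhds_unique (hL g) (tendsto_truncatedPairing hf.1.1 hi)⟩

end AtomPairing

/-! ### Atomic costs of mean-zero functions on small balls. -/

section Costs

variable {M : Type*} [MetricSpace M] [MeasurableSpace M] {μ : Measure M}

theorem IsAtomAtScale.one_mem_atomicCosts {r b : ℝ} {a : Lp ℂ 1 μ} (ha : IsAtomAtScale μ r b a) :
    (1 : ℝ) ∈ atomicCosts μ r b a := by
  have h1 := hasSum_ite_eq (0 : ℕ) (1 : ℝ)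
  have h2 : ∀ k : ℕ, ‖(if k = 0 then (1 : ℂ) else 0)‖ = if k = 0 then (1 : ℝ) else 0 := fun k => by
    split_ifs <;> simp
  refine ⟨fun k => if k = 0 then 1 else 0, fun _ => a, ⟨fun _ => ha, ?_, ?_⟩, ?_⟩
  · simpa only [h2] using h1.summable
  · simpa using hasSum_ite_eq (0 : ℕ) a
  · simp only [h2, h1.tsum_eq]

/-- The cost of a function with mean zero supported in a small ball. -/
theorem mem_atomicCosts_of_eLpNorm_le {r b : ℝ} (hr : 0 < r) {x : M} {ρ : ℝ} (hρ : 0 < ρ)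
    (hρb : ρ ≤ b) {h : Lp ℂ 1 μ} (h0 : ∀ᵐ y ∂μ, y ∉ ball x ρ → h y = 0)
    (hint : ∫ y in ball x ρ, h y ∂μ = 0) {t : ℝ} (ht : 0 < t)
    (hle : ((μ (ball x ρ))⁻¹) ^ (1 / r) *
      eLpNorm h (ENNReal.ofReal r) (μ.restrict (ball x ρ)) ≤
        ENNReal.ofReal t * (μ (ball x ρ))⁻¹) :
    t ∈ atomicCosts μ r b h := by
  have hsm := Lp.coeFn_smul ((t : ℂ)⁻¹) h
  have hat : IsAtomAtScale μ r b ((t : ℂ)⁻¹ • h) := by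
    refine Or.inl ⟨x, ρ, hρ, hρb, ?_, ?_, ?_⟩
    · filter_upwards [h0, hsm] with y hy hy' hyB
      rw [hy', Pi.smul_apply, hy hyB, smul_zero]
    · rw [rpow_inv_mul_lintegral_eq _ _ hr, eLpNorm_congr_ae (ae_restrict_of_ae hsm),
        eLpNorm_const_smul, mul_left_comm]
      have htt : ‖((t : ℂ)⁻¹)‖ₑ * ENNReal.ofReal t = 1 := by
        rw [← ofReal_norm, ← ENNReal.ofReal_mul (norm_nonneg _), norm_inv, Complex.norm_real,
          Real.norm_of_nonneg ht.le, inv_mul_cancel₀ ht.ne', ENNReal.ofReal_one]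
      calc _ ≤ ‖((t : ℂ)⁻¹)‖ₑ * (ENNReal.ofReal t * (μ (ball x ρ))⁻¹) := by gcongr
        _ = _ := by rw [← mul_assoc, htt, one_mul]
    · rw [integral_congr_ae (ae_restrict_of_ae hsm)]
      simp only [Pi.smul_apply]
      rw [integral_smul, hint, smul_zero]
  have := atomicCosts_smul (t : ℂ) hat.one_mem_atomicCosts
  rwa [smul_inv_smul₀ (by exact_mod_cast ht.ne'), Complex.norm_real, Real.norm_of_nonneg ht.le,
    mul_one] at this

end Costs

/-! ### Subtraction of means. -/

section Means

variable {α : Type*} [MeasurableSpace α] {ν : Measure α} [IsFiniteMeasure ν]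

theorem enorm_average_mul_measure_rpow_le {p : ℝ} (hp : 1 ≤ p) {g : α → ℂ}
    (hg : AEStronglyMeasurable g ν) (hν : ν ≠ 0) :
    ‖⨍ x, g x ∂ν‖ₑ * ν univ ^ (1 / p) ≤ eLpNorm g (ENNReal.ofReal p) ν := by
  have hV0 : ν univ ≠ 0 := by simpa using hν
  have hV : ν univ ≠ ∞ := measure_ne_top _ _
  have hp0 : 0 < p := by linarith
  have h1 : ‖⨍ x, g x ∂ν‖ₑ ≤ (ν univ)⁻¹ * eLpNorm g 1 ν := by
    rw [average_eq, enorm_smul, eLpNorm_one_eq_lintegral_enorm]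
    gcongr
    · rw [← ofReal_norm, Real.norm_of_nonneg (by positivity), Measure.real,
        ENNReal.ofReal_inv_of_pos (ENNReal.toReal_pos hV0 hV), ENNReal.ofReal_toReal hV]
    · exact enorm_integral_le_lintegral_enorm _
  have h2 := eLpNorm_le_eLpNorm_mul_rpow_measure_univ
    (show (1 : ℝ≥0∞) ≤ ENNReal.ofReal p by simpa using hp) hg
  rw [ENNReal.toReal_one, ENNReal.toReal_ofReal hp0.le] at h2
  calc _ ≤ (ν univ)⁻¹ * (eLpNorm g (ENNReal.ofReal p) ν * ν univ ^ (1 / 1 - 1 / p)) *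
        ν univ ^ (1 / p) := by gcongr; exact h1.trans (by gcongr)
    _ = eLpNorm g (ENNReal.ofReal p) ν *
        ((ν univ)⁻¹ * (ν univ ^ (1 / 1 - 1 / p) * ν univ ^ (1 / p))) := by ring
    _ = _ := by
        rw [← ENNReal.rpow_add _ _ hV0 hV, sub_add_cancel, div_one, ENNReal.rpow_one,
          ENNReal.inv_mul_cancel hV0 hV, mul_one]

theorem eLpNorm_sub_average_le {p : ℝ} (hp : 1 ≤ p) {g : α → ℂ}
    (hg : AEStronglyMeasurable g ν) :
    eLpNorm (fun x => g x - ⨍ y, g y ∂ν) (ENNReal.ofReal p) ν ≤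
      2 * eLpNorm g (ENNReal.ofReal p) ν := by
  rcases eq_or_ne ν 0 with rfl | hν
  · simp
  have hp0 : ENNReal.ofReal p ≠ 0 := by simp; linarith
  calc _ ≤ eLpNorm g (ENNReal.ofReal p) ν + eLpNorm (fun _ => ⨍ y, g y ∂ν) (ENNReal.ofReal p) ν :=
        eLpNorm_sub_le hg aestronglyMeasurable_const (by simpa using hp)
    _ ≤ eLpNorm g (ENNReal.ofReal p) ν + eLpNorm g (ENNReal.ofReal p) ν := by
        gcongr
        rw [eLpNorm_const' _ hp0 ENNReal.ofReal_ne_top, ENNReal.toReal_ofReal (by linarith)]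
        exact enorm_average_mul_measure_rpow_le hp hg hν
    _ = _ := (two_mul _).symm

omit [IsFiniteMeasure ν] in
-- Subtracting the mean is symmetric for the bilinear pairing, since both corrections equal the
-- product of the two integrals divided by the total mass. It moves the cancellation from `f` to the
-- test function.
theorem integral_sub_average_mul {f g : α → ℂ} (hf : Integrable f ν)
    (hg : Integrable g ν) (hfg : Integrable (fun x => f x * g x) ν) :
    ∫ x, (f x - ⨍ y, f y ∂ν) * g x ∂ν = ∫ x, f x * (g x - ⨍ y, g y ∂ν) ∂ν := by
  simp only [sub_mul, mul_sub]
  rw [integral_sub hfg (hg.const_mul _), integral_sub hfg (hf.mul_const _), integral_const_mul,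
    integral_mul_const, average_eq, average_eq, smul_mul_assoc, mul_smul_comm]

end Means

/-! ### Local representation of a functional bounded by atomic costs. -/

section Functional

variable {M : Type*} [MetricSpace M] [MeasurableSpace M] [BorelSpace M]
  {μ : Measure M} [IsFiniteMeasure μ]

/-- A linear functional on `L¹` (not necessarily continuous) that is bounded by `A` times the
atomic costs at scale `b`. -/
def AtomicBound (μ : Measure M) (r b A : ℝ) (l : Lp ℂ 1 μ →ₗ[ℂ] ℂ) : Prop :=
  ∀ g, ∀ t ∈ atomicCosts μ r b g, ‖l g‖ ≤ A * t

omit [BorelSpace M] in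
-- For every `t > μ(B) ^ (1 / q) ‖h‖_r` the function `h / t` is an atom, so `t` is a cost of `h`;
-- then `t` decreases to the threshold. Strict inequality covers `h = 0`.
theorem AtomicBound.enorm_le {r q b A : ℝ} (hpq : r.HolderConjugate q) {l : Lp ℂ 1 μ →ₗ[ℂ] ℂ}
    (hl : AtomicBound μ r b A l) (hA : 0 ≤ A) {x : M} {ρ : ℝ} (hρ : 0 < ρ) (hρb : ρ ≤ b)
    (hB : μ (ball x ρ) ≠ 0) {h : Lp ℂ 1 μ} (h0 : ∀ᵐ y ∂μ, y ∉ ball x ρ → h y = 0)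
    (hint : ∫ y in ball x ρ, h y ∂μ = 0)
    (hh : MemLp h (ENNReal.ofReal r) (μ.restrict (ball x ρ))) :
    ‖l h‖ₑ ≤ ENNReal.ofReal A * (μ (ball x ρ) ^ (1 / q) *
      eLpNorm h (ENNReal.ofReal r) (μ.restrict (ball x ρ))) := by
  have hV : μ (ball x ρ) ≠ ∞ := measure_ne_top _ _
  have hfin : μ (ball x ρ) ^ (1 / q) *
      eLpNorm h (ENNReal.ofReal r) (μ.restrict (ball x ρ)) ≠ ∞ :=
    ENNReal.mul_ne_top (ENNReal.rpow_ne_top_of_nonneg (one_div_nonneg.2 hpq.symm.pos.le) hV)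
      hh.2.ne
  set X := μ (ball x ρ) ^ (1 / q) * eLpNorm h (ENNReal.ofReal r) (μ.restrict (ball x ρ)) with hX
  have hVq : (μ (ball x ρ))⁻¹ * μ (ball x ρ) ^ (1 / q) = (μ (ball x ρ))⁻¹ ^ (1 / r) := by
    rw [ENNReal.inv_rpow, ← ENNReal.rpow_neg, ← ENNReal.rpow_neg_one, ← ENNReal.rpow_add _ _ hB hV]
    congr 1
    have := hpq.inv_add_inv_eq_one
    rw [one_div, one_div]
    linarith
  have key : ∀ t : ℝ, X.toReal < t → ‖l h‖ ≤ A * t := by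
    intro t ht
    refine hl h t (mem_atomicCosts_of_eLpNorm_le hpq.pos hρ hρb h0 hint
      (ENNReal.toReal_nonneg.trans_lt ht) ?_)
    rw [← hVq, mul_assoc, ← hX, mul_comm]
    gcongr
    exact (ENNReal.le_ofReal_iff_toReal_le hfin (ENNReal.toReal_nonneg.trans ht.le)).2 ht.le
  have h1 : ‖l h‖ ≤ A * X.toReal := by
    refine le_of_forall_pos_le_add fun ε hε => ?_
    -- The divisor `A + 1` permits `A = 0`.
    have h2 := key (X.toReal + ε / (A + 1)) (lt_add_of_pos_right _ (by positivity))
    refine h2.trans ?_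
    rw [mul_add]
    gcongr
    rw [mul_div_assoc', div_le_iff₀ (by linarith)]
    nlinarith
  rw [← ofReal_norm, ← ENNReal.ofReal_toReal hfin, ← ENNReal.ofReal_mul hA]
  exact ENNReal.ofReal_le_ofReal h1

omit [MetricSpace M] [BorelSpace M] in
theorem memLp_one_indicator_of_memLp_restrict {p : ℝ≥0∞} (hp : 1 ≤ p) {B : Set M}
    (hB : MeasurableSet B) {φ : M → ℂ} (hφ : MemLp φ p (μ.restrict B)) :
    MemLp (B.indicator φ) 1 μ :=
  (memLp_indicator_iff_restrict hB).2 (hφ.mono_exponent hp)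

/-- The bound for the functional on functions with the mean subtracted. -/
theorem AtomicBound.enorm_sub_average_le {r q b A : ℝ} (hpq : r.HolderConjugate q)
    {l : Lp ℂ 1 μ →ₗ[ℂ] ℂ} (hl : AtomicBound μ r b A l) (hA : 0 ≤ A) {x : M} {ρ : ℝ}
    (hρ : 0 < ρ) (hρb : ρ ≤ b) (hB : μ (ball x ρ) ≠ 0) {φ : M → ℂ}
    (hφ : MemLp φ (ENNReal.ofReal r) (μ.restrict (ball x ρ)))
    (hm : MemLp ((ball x ρ).indicator fun y => φ y - ⨍ w in ball x ρ, φ w ∂μ) 1 μ) :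
    ‖l hm.toLp‖ₑ ≤ ENNReal.ofReal A * (μ (ball x ρ) ^ (1 / q) *
      (2 * eLpNorm φ (ENNReal.ofReal r) (μ.restrict (ball x ρ)))) := by
  have hr1 : 1 ≤ r := hpq.lt.le
  have hV0 : μ.restrict (ball x ρ) ≠ 0 := by simpa using hB
  have hae : hm.toLp =ᵐ[μ.restrict (ball x ρ)] fun y => φ y - ⨍ w in ball x ρ, φ w ∂μ := by
    filter_upwards [ae_restrict_of_ae hm.coeFn_toLp, ae_restrict_mem measurableSet_ball]
      with y hy hyB
    rw [hy, indicator_of_mem hyB]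
  have hφi : IntegrableOn φ (ball x ρ) μ :=
    hφ.integrable (by simpa using hr1)
  refine (hl.enorm_le hpq hA hρ hρb hB ?_ ?_ ?_).trans ?_
  · filter_upwards [hm.coeFn_toLp] with y hy hyB
    rw [hy, indicator_of_notMem hyB]
  · rw [integral_congr_ae hae]
    exact integral_sub_average _ _
  · exact (memLp_congr_ae hae).2 (hφ.sub (memLp_const _))
  · rw [eLpNorm_congr_ae hae]
    gcongr
    exact eLpNorm_sub_average_le hr1 hφ.1

/-- The functional is represented by a function on each small ball. -/
theorem AtomicBound.exists_representation_on_ball {r q b A : ℝ} (hpq : r.HolderConjugate q)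
    {l : Lp ℂ 1 μ →ₗ[ℂ] ℂ} (hl : AtomicBound μ r b A l) (hA : 0 ≤ A) {x : M} {ρ : ℝ}
    (hρ : 0 < ρ) (hρb : ρ ≤ b) (hB : μ (ball x ρ) ≠ 0) :
    ∃ f : M → ℂ, Measurable f ∧ MemLp f (ENNReal.ofReal q) (μ.restrict (ball x ρ)) ∧
      ∀ h : Lp ℂ 1 μ, (∀ᵐ y ∂μ, y ∉ ball x ρ → h y = 0) →
        MemLp h (ENNReal.ofReal r) (μ.restrict (ball x ρ)) → l h = ∫ y, f y * h y ∂μ := by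
  have hr1 : 1 ≤ ENNReal.ofReal r := by simpa using hpq.lt.le
  have : Fact (1 ≤ ENNReal.ofReal r) := ⟨hr1⟩
  set B := ball x ρ with hBdef
  have hBm : MeasurableSet B := measurableSet_ball
  have hV0 : μ.restrict B ≠ 0 := by simpa using hB
  have hV : μ B ≠ ∞ := measure_ne_top _ _
  have hind : ∀ φ : Lp ℂ (ENNReal.ofReal r) (μ.restrict B), MemLp (B.indicator φ) 1 μ := fun φ =>
    memLp_one_indicator_of_memLp_restrict hr1 hBm (Lp.memLp φ)
  have hone : MemLp (B.indicator fun _ => (1 : ℂ)) 1 μ :=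
    memLp_one_indicator_of_memLp_restrict hr1 hBm (memLp_const 1)
  have hext : ∀ {φ ψ : M → ℂ}, φ =ᵐ[μ.restrict B] ψ → B.indicator φ =ᵐ[μ] B.indicator ψ :=
    fun h => (ae_restrict_iff' hBm |>.1 h).mono fun y hy => by
      by_cases hyB : y ∈ B
      · simp only [indicator_of_mem hyB]; exact hy hyB
      · simp only [indicator_of_notMem hyB]
  set T₀ : Lp ℂ (ENNReal.ofReal r) (μ.restrict B) →ₗ[ℂ] ℂ :=
    { toFun := fun φ => l (hind φ).toLp
      map_add' := fun φ ψ => by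
        rw [← map_add, ← MemLp.toLp_add]
        congr 1
        refine MemLp.toLp_congr _ _ ?_
        rw [← indicator_add']
        exact hext (Lp.coeFn_add φ ψ)
      map_smul' := fun c φ => by
        rw [RingHom.id_apply, ← map_smul, ← MemLp.toLp_const_smul]
        congr 1
        refine MemLp.toLp_congr _ _ ?_
        refine (hext (Lp.coeFn_smul c φ)).trans (ae_of_all _ fun y => ?_)
        by_cases hy : y ∈ B <;> simp [hy] } with hT₀
  have hbound : ∃ C : ℝ, ∀ φ, ‖T₀ φ‖ ≤ C * ‖φ‖ := by
    -- Split `φ` into its mean-zero part and a multiple of the indicator of `B`. The value of `l` on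
    -- the indicator is merely finite, not controlled by `A`; here only some bound is needed, and
    -- the uniform oscillation estimate does not use it.
    set c : ℝ≥0∞ := ENNReal.ofReal A * (μ B ^ (1 / q) * 2) +
      (μ B ^ (1 / r))⁻¹ * ‖l hone.toLp‖ₑ with hc
    have hrpos : μ B ^ (1 / r) ≠ 0 := by simp [hB, hV]
    have hrtop : μ B ^ (1 / r) ≠ ∞ := ENNReal.rpow_ne_top_of_nonneg
      (one_div_nonneg.2 hpq.pos.le) hV
    have hctop : c ≠ ∞ := by
      have h1 : μ B ^ (1 / q) ≠ ∞ := ENNReal.rpow_ne_top_of_nonneg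
        (one_div_nonneg.2 hpq.symm.pos.le) hV
      refine ENNReal.add_ne_top.2 ⟨by finiteness, ENNReal.mul_ne_top ?_ enorm_ne_top⟩
      exact ENNReal.inv_ne_top.2 hrpos
    refine ⟨c.toReal, fun φ => ?_⟩
    have hφ := Lp.memLp φ
    set m := ⨍ w in B, φ w ∂μ
    have hsub : MemLp (B.indicator fun y => φ y - m) 1 μ :=
      memLp_one_indicator_of_memLp_restrict hr1 hBm (hφ.sub (memLp_const m))
    have hdec : (hind φ).toLp = hsub.toLp + m • hone.toLp := by
      rw [← MemLp.toLp_const_smul, ← MemLp.toLp_add]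
      refine MemLp.toLp_congr _ _ (ae_of_all _ fun y => ?_)
      by_cases hy : y ∈ B <;> simp [hy]
    have hm : ‖m‖ₑ ≤ (μ B ^ (1 / r))⁻¹ * eLpNorm φ (ENNReal.ofReal r) (μ.restrict B) := by
      have := enorm_average_mul_measure_rpow_le hpq.lt.le hφ.1 hV0
      rw [Measure.restrict_apply_univ] at this
      rw [mul_comm, ← div_eq_mul_inv]
      exact (ENNReal.le_div_iff_mul_le (Or.inl hrpos) (Or.inl hrtop)).2 this
    have hle : ‖T₀ φ‖ₑ ≤ c * ‖φ‖ₑ := by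
      rw [hT₀, LinearMap.coe_mk, AddHom.coe_mk, hdec, map_add, map_smul]
      refine (enorm_add_le _ _).trans ?_
      rw [smul_eq_mul, enorm_mul, Lp.enorm_def]
      calc _ ≤ ENNReal.ofReal A * (μ B ^ (1 / q) *
              (2 * eLpNorm φ (ENNReal.ofReal r) (μ.restrict B))) +
            (μ B ^ (1 / r))⁻¹ * eLpNorm φ (ENNReal.ofReal r) (μ.restrict B) *
              ‖l hone.toLp‖ₑ := by
            gcongr
            exact hl.enorm_sub_average_le hpq hA hρ hρb hB hφ hsub
        _ = _ := by rw [hc]; ring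
    rw [← toReal_enorm, ← toReal_enorm φ, ← ENNReal.toReal_mul]
    exact ENNReal.toReal_mono (ENNReal.mul_ne_top hctop enorm_ne_top) hle
  obtain ⟨C, hC⟩ := hbound
  obtain ⟨f, hf, hTf⟩ := exists_memLp_forall_dual_eq_integral hpq (T₀.mkContinuous C hC)
  -- A measurable version on the whole space, as needed for gluing.
  refine ⟨hf.1.mk f, hf.1.stronglyMeasurable_mk.measurable, hf.ae_eq hf.1.ae_eq_mk,
    fun h h0 hh => ?_⟩
  have h1 : h = (hind hh.toLp).toLp := by
    refine Lp.ext ?_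
    filter_upwards [(hind hh.toLp).coeFn_toLp, hext hh.coeFn_toLp, h0] with y hy hy' hy0
    rw [hy, hy']
    by_cases hyB : y ∈ B
    · rw [indicator_of_mem hyB]
    · rw [indicator_of_notMem hyB, hy0 hyB]
  calc l h = T₀.mkContinuous C hC hh.toLp := congrArg l h1
    _ = ∫ y in B, f y * hh.toLp h y ∂μ := hTf _
    _ = ∫ y in B, hf.1.mk f y * h y ∂μ := by
        refine integral_congr_ae ?_
        filter_upwards [hf.1.ae_eq_mk, hh.coeFn_toLp] with y hy hy'
        rw [hy, hy']
    _ = _ := setIntegral_eq_integral_of_ae_compl_eq_zero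
        (h0.mono fun y hy hyB => by rw [hy hyB, mul_zero])

end Functional

/-! ### Gluing the local representatives and bounding the oscillation. -/

section GlobalRepresentation

variable {M : Type*} [MetricSpace M] [MeasurableSpace M] [BorelSpace M]
  {μ : Measure M} [IsFiniteMeasure μ]

/-- A countable measurable partition into subsets of balls of a given radius, finite on bounded
sets. -/
theorem LocallyDoubling.exists_partition (hLD : LocallyDoubling μ) (hμ : μ ≠ 0) {s : ℝ}
    (hs : 0 < s) :
    ∃ (z : ℕ → M) (E : ℕ → Set M), (∀ i, MeasurableSet (E i)) ∧
      Pairwise (Function.onFun Disjoint E) ∧ (∀ i, E i ⊆ ball (z i) s) ∧ (⋃ i, E i = univ) ∧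
      ∀ (x : M) (R : ℝ), {i | (E i ∩ ball x R).Nonempty}.Finite := by
  obtain ⟨Z, hZc, hcov, -, hfin⟩ := hLD.exists_net hμ hs
  have hne : Nonempty M := by
    by_contra hemp
    rw [not_nonempty_iff] at hemp
    exact hμ (Measure.eq_zero_of_isEmpty μ)
  have hZne : Z.Nonempty := by
    obtain ⟨z, hz, -⟩ := hcov hne.some
    exact ⟨z, hz⟩
  obtain ⟨z, rfl⟩ := hZc.exists_eq_range hZne
  refine ⟨z, disjointed fun i => ball (z i) s, fun i => MeasurableSet.disjointed
    (fun _ => measurableSet_ball) i, disjoint_disjointed _, disjointed_subset _, ?_,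
    fun x R => ?_⟩
  · rw [iUnion_disjointed]
    refine eq_univ_of_forall fun x => ?_
    obtain ⟨_, ⟨i, rfl⟩, hi⟩ := hcov x
    exact mem_iUnion.2 ⟨i, hi⟩
  · refine Set.Finite.of_finite_image (f := z) ((hfin x (R + s)).subset ?_) ?_
    · rintro _ ⟨i, ⟨y, hyE, hyB⟩, rfl⟩
      refine ⟨mem_range_self i, ?_⟩
      have h1 := disjointed_subset (fun i => ball (z i) s) i hyE
      rw [mem_ball] at h1 hyB
      rw [dist_comm] at h1
      linarith [dist_triangle (z i) y x]
    -- The enumeration of the net may repeat points, but a repeated ball contributes an empty piece;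
    -- so the indices of nonempty pieces inject into the net.
    · have hlt : ∀ i j, i < j → z i = z j →
          disjointed (fun i => ball (z i) s) j = ∅ := fun i j hij hz => by
        rw [eq_empty_iff_forall_notMem]
        intro y hy
        have h1 := disjointed_subset (fun i => ball (z i) s) j hy
        rw [disjointed_apply] at hy
        refine hy.2 ?_
        rw [Finset.sup_set_eq_biUnion]
        refine mem_iUnion₂.2 ⟨i, Finset.mem_Iio.2 hij, ?_⟩
        simpa [hz] using h1
      intro i ⟨y, hy, _⟩ j ⟨w, hw, _⟩ hij
      rcases lt_trichotomy i j with h | h | h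
      · exact absurd hw (by rw [hlt i j h hij]; exact notMem_empty w)
      · exact h
      · exact absurd hy (by rw [hlt j i h hij.symm]; exact notMem_empty y)

/-- The functional is represented by a locally `L^q` function on boundedly supported functions. -/
theorem AtomicBound.exists_representation (hLD : LocallyDoubling μ) (hμ : μ ≠ 0) {r q b A : ℝ}
    (hpq : r.HolderConjugate q) {l : Lp ℂ 1 μ →ₗ[ℂ] ℂ} (hl : AtomicBound μ r b A l) (hA : 0 ≤ A)
    (hb : 0 < b) :
    ∃ f : M → ℂ, Measurable f ∧
      (∀ x R, MemLp f (ENNReal.ofReal q) (μ.restrict (ball x R))) ∧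
      ∀ (h : Lp ℂ 1 μ) (x : M) (R : ℝ), (∀ᵐ y ∂μ, y ∉ ball x R → h y = 0) →
        MemLp h (ENNReal.ofReal r) (μ.restrict (ball x R)) → l h = ∫ y, f y * h y ∂μ := by
  obtain ⟨z, E, hEm, hEd, hEs, hEu, hEf⟩ := hLD.exists_partition hμ hb
  choose F hFm hFq hF using fun i => hl.exists_representation_on_ball hpq hA hb le_rfl
    (hLD.measure_ball_pos hμ (z i) hb).ne'
  -- On each piece the local representative of its own ball is taken. No compatibility is required,
  -- since the pieces are disjoint and every representative comes from the same `l`.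
  obtain ⟨f, hfm, hfE⟩ := exists_measurable_piecewise E hEm F hFm fun i j hij y hy =>
    absurd hy (by rw [(hEd hij).inter_eq]; exact notMem_empty y)
  have hcover : ∀ x R, ball x R ⊆ ⋃ i ∈ {i | (E i ∩ ball x R).Nonempty}, E i := fun x R y hy => by
    obtain ⟨i, hi⟩ := mem_iUnion.1 (hEu.symm ▸ mem_univ y : y ∈ ⋃ i, E i)
    exact mem_iUnion₂.2 ⟨i, ⟨y, hi, hy⟩, hi⟩
  have hfloc : ∀ x R, MemLp f (ENNReal.ofReal q) (μ.restrict (ball x R)) := fun x R => by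
    refine memLp_restrict_of_subset_biUnion hpq.symm.pos hfm.aestronglyMeasurable (hEf x R)
      (fun i _ => ?_) (hcover x R)
    refine (memLp_congr_ae ?_).2 ((hFq i).mono_measure (Measure.restrict_mono_set μ (hEs i)))
    filter_upwards [ae_restrict_mem (hEm i)] with y hy using hfE i hy
  refine ⟨f, hfm, hfloc, fun h x R h0 hh => ?_⟩
  have hh1 : MemLp h 1 μ := Lp.memLp h
  have hhi : ∀ i, MemLp ((E i).indicator h) 1 μ := fun i => hh1.indicator (hEm i)
  have : ENNReal.HolderConjugate (ENNReal.ofReal q) (ENNReal.ofReal r) := hpq.symm.ennrealOfReal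
  have hfh : Integrable (fun y => f y * h y) μ := by
    have h1 : IntegrableOn (fun y => f y * h y) (ball x R) μ := (hfloc x R).integrable_mul hh
    exact h1.integrable_of_ae_notMem_eq_zero (h0.mono fun y hy hyB => by rw [hy hyB, mul_zero])
  have hpiece : ∀ i, l (hhi i).toLp = ∫ y in E i, f y * h y ∂μ := by
    intro i
    rw [hF i (hhi i).toLp]
    · rw [← integral_indicator (hEm i)]
      refine integral_congr_ae ?_
      filter_upwards [(hhi i).coeFn_toLp] with y hy
      rw [hy]
      by_cases hyE : y ∈ E i
      · rw [indicator_of_mem hyE, indicator_of_mem hyE, hfE i hyE]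
      · rw [indicator_of_notMem hyE, indicator_of_notMem hyE, mul_zero]
    · filter_upwards [(hhi i).coeFn_toLp] with y hy hyB
      rw [hy, indicator_of_notMem fun hyE => hyB (hEs i hyE)]
    · have h1 : MemLp h (ENNReal.ofReal r) μ := by
        refine (memLp_congr_ae ?_).1 ((memLp_indicator_iff_restrict measurableSet_ball).2 hh)
        filter_upwards [h0] with y hy
        by_cases hyB : y ∈ ball x R
        · rw [indicator_of_mem hyB]
        · rw [indicator_of_notMem hyB, hy hyB]
      exact (memLp_congr_ae (ae_restrict_of_ae (hhi i).coeFn_toLp)).2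
        ((h1.indicator (hEm i)).restrict _)
  set I := (hEf x R).toFinset
  have hIE : ∀ᵐ y ∂μ, y ∉ ⋃ i ∈ I, E i → h y = 0 := h0.mono fun y hy hyI => hy fun hyB =>
    hyI (by simpa [I] using hcover x R hyB)
  -- A bounded support meets finitely many pieces, so linearity of `l` suffices; `l` need not be
  -- continuous on `L¹`.
  have hsum : h = ∑ i ∈ I, (hhi i).toLp := by
    refine Lp.ext ?_
    have h1 : ∀ᵐ y ∂μ, ∀ i, (hhi i).toLp _ y = (E i).indicator h y :=
      ae_all_iff.2 fun i => (hhi i).coeFn_toLp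
    filter_upwards [Lp.coeFn_finsetSum I (fun i => (hhi i).toLp), h1, hIE] with y hy hy1 hyI
    rw [hy, Finset.sum_apply, Finset.sum_congr rfl fun i _ => hy1 i]
    by_cases hyU : y ∈ ⋃ i ∈ I, E i
    · obtain ⟨i, hi, hyi⟩ := mem_iUnion₂.1 hyU
      rw [Finset.sum_eq_single_of_mem i hi, indicator_of_mem hyi]
      intro j _ hji
      exact indicator_of_notMem (fun hyj => (hEd hji).le_bot ⟨hyj, hyi⟩) _
    · rw [hyI hyU, Finset.sum_eq_zero]
      intro i hi
      exact indicator_of_notMem (fun hyi => hyU (mem_iUnion₂.2 ⟨i, hi, hyi⟩)) _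
  calc l h = ∑ i ∈ I, l (hhi i).toLp := by rw [← map_sum]; exact congrArg l hsum
    _ = ∑ i ∈ I, ∫ y in E i, f y * h y ∂μ := Finset.sum_congr rfl fun i _ => hpiece i
    _ = ∫ y in ⋃ i ∈ I, E i, f y * h y ∂μ := by
        rw [integral_biUnion_finset I (fun i _ => hEm i) (fun i _ j _ hij => hEd hij)
          fun i _ => hfh.integrableOn]
    _ = _ := setIntegral_eq_integral_of_ae_compl_eq_zero
        (hIE.mono fun y hy hyI => by rw [hy hyI, mul_zero])

/-- The oscillation of the representing function. -/
theorem AtomicBound.average_le {r q b A : ℝ}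
    (hpq : r.HolderConjugate q) {l : Lp ℂ 1 μ →ₗ[ℂ] ℂ} (hl : AtomicBound μ r b A l) (hA : 0 ≤ A)
    {f : M → ℂ} (hfq : ∀ x R, MemLp f (ENNReal.ofReal q) (μ.restrict (ball x R)))
    (hf : ∀ (h : Lp ℂ 1 μ) (x : M) (R : ℝ), (∀ᵐ y ∂μ, y ∉ ball x R → h y = 0) →
      MemLp h (ENNReal.ofReal r) (μ.restrict (ball x R)) → l h = ∫ y, f y * h y ∂μ)
    {x : M} {ρ : ℝ} (hρ : 0 < ρ) (hρb : ρ ≤ b) (hB : μ (ball x ρ) ≠ 0) :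
    ((μ (ball x ρ))⁻¹ * ∫⁻ y in ball x ρ, ‖f y - ⨍ w in ball x ρ, f w ∂μ‖ₑ ^ q ∂μ) ^ (1 / q) ≤
      ENNReal.ofReal (2 * A) := by
  have hq0 : 0 ≤ 1 / q := one_div_nonneg.2 hpq.symm.pos.le
  have hV : μ (ball x ρ) ≠ ∞ := measure_ne_top _ _
  set B := ball x ρ with hBdef
  have hBm : MeasurableSet B := measurableSet_ball
  have hr1 : 1 ≤ ENNReal.ofReal r := by simpa using hpq.lt.le
  have hq1 : 1 ≤ ENNReal.ofReal q := by simpa using hpq.symm.lt.le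
  have hfB : MemLp f (ENNReal.ofReal q) (μ.restrict B) := hfq x ρ
  have hfi : IntegrableOn f B μ := hfB.integrable hq1
  have key : eLpNorm (fun y => f y - ⨍ w in B, f w ∂μ) (ENNReal.ofReal q) (μ.restrict B) ≤
      ENNReal.ofReal (2 * A) * μ B ^ (1 / q) := by
    refine eLpNorm_le_of_forall_bounded hpq (hfB.1.sub aestronglyMeasurable_const)
      fun g hg ⟨K, hK⟩ => ?_
    have hgr : MemLp g (ENNReal.ofReal r) (μ.restrict B) :=
      MemLp.of_bound hg.aestronglyMeasurable K (ae_of_all _ hK)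
    have hgi : IntegrableOn g B μ := hgr.integrable hr1
    set m := ⨍ w in B, g w ∂μ
    have hm : MemLp (B.indicator fun y => g y - m) 1 μ :=
      memLp_one_indicator_of_memLp_restrict hr1 hBm (hgr.sub (memLp_const m))
    have hae : hm.toLp =ᵐ[μ.restrict B] fun y => g y - m := by
      filter_upwards [ae_restrict_of_ae hm.coeFn_toLp, ae_restrict_mem hBm] with y hy hyB
      rw [hy, indicator_of_mem hyB]
    have hoff : ∀ᵐ y ∂μ, y ∉ B → hm.toLp _ y = 0 := by
      filter_upwards [hm.coeFn_toLp] with y hy hyB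
      rw [hy, indicator_of_notMem hyB]
    -- The mean is moved onto `g`, and `g` minus its mean is a function to which the atomic bound
    -- applies. Its norm is at most twice that of `g`, whence `2 * A`.
    have h1 : ∫ y in B, (f y - ⨍ w in B, f w ∂μ) * g y ∂μ = l hm.toLp := by
      rw [integral_sub_average_mul hfi hgi
        (hfi.mul_bdd hg.aestronglyMeasurable (ae_of_all _ hK)),
        hf _ x ρ hoff ((memLp_congr_ae hae).2 (hgr.sub (memLp_const _))),
        ← setIntegral_eq_integral_of_ae_compl_eq_zero (s := B)
          (hoff.mono fun y hy hyB => by rw [hy hyB, mul_zero])]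
      refine integral_congr_ae ?_
      filter_upwards [hae] with y hy
      rw [hy]
    refine (congrArg enorm h1).trans_le ?_
    refine (hl.enorm_sub_average_le hpq hA hρ hρb hB hgr hm).trans_eq ?_
    rw [ENNReal.ofReal_mul (by norm_num), ENNReal.ofReal_ofNat]
    ring
  rw [rpow_inv_mul_lintegral_eq _ _ hpq.symm.pos (fun y => f y - ⨍ w in B, f w ∂μ)]
  calc _ ≤ (μ B)⁻¹ ^ (1 / q) * (ENNReal.ofReal (2 * A) * μ B ^ (1 / q)) := by gcongr
    _ = ENNReal.ofReal (2 * A) * ((μ B)⁻¹ ^ (1 / q) * μ B ^ (1 / q)) := by ring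
    _ = _ := by
        rw [← ENNReal.mul_rpow_of_nonneg _ _ hq0, ENNReal.inv_mul_cancel hB hV,
          ENNReal.one_rpow, mul_one]

omit [MetricSpace M] [BorelSpace M] in
/-- An `L^q` oscillation bound implies an `L¹` oscillation bound. -/
theorem setIntegral_norm_sub_le_of_average_le {q A : ℝ} (hq : 1 ≤ q) (hA : 0 ≤ A) {B : Set M}
    (hB : μ B ≠ 0) {f : M → ℂ} (hf : AEStronglyMeasurable f (μ.restrict B)) {m : ℂ}
    (h : ((μ B)⁻¹ * ∫⁻ y in B, ‖f y - m‖ₑ ^ q ∂μ) ^ (1 / q) ≤ ENNReal.ofReal A) :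
    ∫ y in B, ‖f y - m‖ ∂μ ≤ A * μ.real B := by
  have hq0 : 0 < q := by linarith
  have hV : μ B ≠ ∞ := measure_ne_top _ _
  rw [rpow_inv_mul_lintegral_eq _ _ hq0 (fun y => f y - m)] at h
  have hfm : AEStronglyMeasurable (fun y => f y - m) (μ.restrict B) :=
    hf.sub aestronglyMeasurable_const
  have h2 := eLpNorm_le_eLpNorm_mul_rpow_measure_univ
    (show (1 : ℝ≥0∞) ≤ ENNReal.ofReal q by simpa using hq) hfm
  rw [ENNReal.toReal_one, ENNReal.toReal_ofReal hq0.le, Measure.restrict_apply_univ, div_one,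
    ENNReal.rpow_sub _ _ hB hV, ENNReal.rpow_one, div_eq_mul_inv, ← ENNReal.inv_rpow] at h2
  have h3 : eLpNorm (fun y => f y - m) 1 (μ.restrict B) ≤ ENNReal.ofReal (A * μ.real B) := by
    rw [ENNReal.ofReal_mul hA, ofReal_measureReal]
    calc _ ≤ μ B * ((μ B)⁻¹ ^ (1 / q) *
          eLpNorm (fun y => f y - m) (ENNReal.ofReal q) (μ.restrict B)) :=
          h2.trans_eq (by ring)
      _ ≤ μ B * ENNReal.ofReal A := by gcongr
      _ = _ := mul_comm _ _
  rw [eLpNorm_one_eq_lintegral_enorm] at h3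
  rw [integral_norm_eq_lintegral_enorm hfm]
  exact ENNReal.toReal_le_of_le_ofReal (by positivity) h3

end GlobalRepresentation

/-! ### Normalisation of the constant and the duality theorem. -/

section Duality

variable {M : Type*} [MetricSpace M] [MeasurableSpace M] [BorelSpace M]
  {μ : Measure M} [IsFiniteMeasure μ]

omit [MetricSpace M] [BorelSpace M] in
theorem average_add_const {f : M → ℂ} {B : Set M} (hB : μ B ≠ 0) (hf : IntegrableOn f B μ)
    (c : ℂ) : ⨍ w in B, (f w + c) ∂μ = (⨍ w in B, f w ∂μ) + c := by
  have hBr : μ.real B ≠ 0 := (ENNReal.toReal_pos hB (measure_ne_top _ _)).ne'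
  rw [setAverage_eq, setAverage_eq, integral_add hf (integrable_const c), setIntegral_const,
    smul_add, inv_smul_smul₀ hBr]

omit [BorelSpace M] in
theorem eq_integral_of_mem_finiteAtomic (hLD : LocallyDoubling μ) (hμ : μ ≠ 0) {r q : ℝ}
    (hpq : r.HolderConjugate q) {l : Lp ℂ 1 μ →ₗ[ℂ] ℂ} {f : M → ℂ} (hf : Integrable f μ)
    (hfq : ∀ x R, MemLp f (ENNReal.ofReal q) (μ.restrict (ball x R)))
    (hstd : ∀ (x : M) (ρ : ℝ) (a : Lp ℂ 1 μ), 0 < ρ → IsStandardAtomOn μ r x ρ a →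
      l a = ∫ y, f y * a y ∂μ)
    (hexc : ∀ a : Lp ℂ 1 μ, IsExceptionalAtom μ a → l a = ∫ y, f y * a y ∂μ)
    {g : Lp ℂ 1 μ} (hg : g ∈ finiteAtomic μ r) : l g = ∫ y, f y * g y ∂μ := by
  have hi : ∀ g ∈ finiteAtomic μ r, Integrable (fun y => f y * g y) μ := fun g hg =>
    integrable_mul_of_mem_finiteAtomic hLD hμ hpq hf hfq hg
  induction hg using Submodule.span_induction with
  | mem a ha =>
    rcases ha with ⟨x, ρ, hρ, ha⟩ | ha
    · exact hstd x ρ a hρ ha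
    · exact hexc a ha
  | zero =>
    rw [map_zero, eq_comm]
    refine integral_eq_zero_of_ae ?_
    filter_upwards [Lp.coeFn_zero ℂ 1 μ] with x hx
    simp only [hx, Pi.zero_apply, mul_zero]
  | add g h hg hh ihg ihh =>
    rw [map_add, ihg, ihh, ← integral_add (hi g hg) (hi h hh)]
    refine integral_congr_ae ?_
    filter_upwards [Lp.coeFn_add g h] with x hx
    rw [hx, Pi.add_apply, mul_add]
  | smul c g _ ih =>
    rw [map_smul, ih, smul_eq_mul, ← integral_const_mul]
    refine integral_congr_ae ?_
    filter_upwards [Lp.coeFn_smul c g] with x hx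
    rw [hx, Pi.smul_apply, smul_eq_mul]
    ring

omit [MetricSpace M] [BorelSpace M] in
theorem exists_isExceptionalAtom (μ : Measure M) [IsFiniteMeasure μ] :
    ∃ e : Lp ℂ 1 μ, IsExceptionalAtom μ e :=
  ⟨(memLp_const (((μ.real univ)⁻¹ : ℝ) : ℂ)).toLp, MemLp.coeFn_toLp _⟩

/-- Functionals bounded by the atomic costs are represented by functions in `BMO`. -/
theorem exists_memBMO_of_atomicBound (hLD : LocallyDoubling μ) (hμ : μ ≠ 0) {R₀ β : ℝ}
    (hAM : ApproxMidpoint M R₀ β) (hCI : ComplIsoperimetric μ) {r q : ℝ}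
    (hpq : r.HolderConjugate q) {b : ℝ} (hb : 2 * R₀ < b) :
    ∃ C : ℝ, ∀ (l : Lp ℂ 1 μ →ₗ[ℂ] ℂ) (A : ℝ), 0 < A → AtomicBound μ r b A l →
      ∃ f : M → ℂ, MemBMO μ q b f ∧ bmoNorm μ q b f ≤ C * A ∧
        ∀ g ∈ finiteAtomic μ r, Integrable (fun x => f x * g x) μ ∧ l g = ∫ x, f x * g x ∂μ := by
  have hb0 : 0 < b := by linarith [hAM.1]
  -- Smoothing at scale `b / 2` uses oscillation on balls of radius exactly `b`, the largest
  -- available.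
  obtain ⟨C, hC, hosc⟩ := exists_lintegral_norm_sub_le_of_oscillation hLD hμ hAM hCI
    (show R₀ < b / 2 by linarith)
  rw [show 2 * (b / 2) = b by ring] at hosc
  set V := μ.real univ with hVdef
  have hV : 0 < V := ENNReal.toReal_pos (by simpa using hμ) (measure_ne_top _ _)
  -- The oscillation contributes `2 A`, the norm of `f₀ - c` contributes `2 C A`, and `‖d‖ V`
  -- contributes `V A + 2 C A`.
  refine ⟨4 * C.toReal + V + 2, fun l A hA hl => ?_⟩
  obtain ⟨f₀, hf₀m, hf₀q, hf₀⟩ := hl.exists_representation hLD hμ hpq hA.le hb0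
  have hq1 : 1 ≤ ENNReal.ofReal q := by simpa using hpq.symm.lt.le
  have hf₀i : ∀ x R, IntegrableOn f₀ (ball x R) μ := fun x R => (hf₀q x R).integrable hq1
  have hpos : ∀ (x : M) {ρ : ℝ}, 0 < ρ → μ (ball x ρ) ≠ 0 := fun x ρ hρ =>
    (hLD.measure_ball_pos hμ x hρ).ne'
  have havg := fun {x : M} {ρ : ℝ} (hρ : 0 < ρ) (hρb : ρ ≤ b) =>
    hl.average_le hpq hA.le hf₀q hf₀ hρ hρb (hpos x hρ)
  obtain ⟨c, hc⟩ := hosc f₀ (fun x => ⨍ w in ball x b, f₀ w ∂μ) (2 * A) (by positivity)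
    (fun x => hf₀i x b) fun x => setIntegral_norm_sub_le_of_average_le hpq.symm.lt.le
      (by positivity) (hpos x hb0) hf₀m.aestronglyMeasurable (havg hb0 le_rfl)
  have hfc : Integrable (fun y => f₀ y - c) μ :=
    ⟨(hf₀m.sub_const c).aestronglyMeasurable, hc.trans_lt (by finiteness)⟩
  have hfcn : ∫ y, ‖f₀ y - c‖ ∂μ ≤ C.toReal * (2 * A) := by
    rw [integral_norm_eq_lintegral_enorm hfc.1,
      ← ENNReal.toReal_ofReal (show 0 ≤ 2 * A by positivity),
      ← ENNReal.toReal_mul]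
    exact ENNReal.toReal_mono (by finiteness) hc
  obtain ⟨e, he⟩ := exists_isExceptionalAtom μ
  have hle : ‖l e‖ ≤ A := by
    simpa using hl e 1 (IsAtomAtScale.one_mem_atomicCosts (r := r) (b := b) (Or.inr he))
  -- Chosen so that the mean of `f = f₀ - c + d` over the whole space equals `l e`.
  set d : ℂ := l e - ((V⁻¹ : ℝ) : ℂ) * ∫ y, (f₀ y - c) ∂μ with hd
  set f : M → ℂ := fun y => f₀ y + (d - c) with hfdef
  have hfeq : f = fun y => (f₀ y - c) + d := by ext y; simp only [hfdef]; ring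
  have hfi : Integrable f μ := by rw [hfeq]; exact hfc.add (integrable_const d)
  have hfq : ∀ x R, MemLp f (ENNReal.ofReal q) (μ.restrict (ball x R)) := fun x R =>
    (hf₀q x R).add (memLp_const _)
  have hmo : meanOscillation μ q b f ≤ ENNReal.ofReal (2 * A) := by
    refine iSup_le fun x => iSup_le fun ρ => iSup_le fun hρ => iSup_le fun hρb => ?_
    rw [hfdef, average_add_const (hpos x hρ) (hf₀i x ρ)]
    simpa only [add_sub_add_right_eq_sub] using havg hρ hρb
  have hbmo : MemBMO μ q b f := ⟨hfi, hmo.trans_lt ENNReal.ofReal_lt_top⟩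
  refine ⟨f, hbmo, ?_, fun g hg => ⟨integrable_mul_of_mem_finiteAtomic hLD hμ hpq hfi hfq hg,
    eq_integral_of_mem_finiteAtomic hLD hμ hpq hfi hfq ?_ ?_ hg⟩⟩
  · have h1 : (meanOscillation μ q b f).toReal ≤ 2 * A :=
      ENNReal.toReal_le_of_le_ofReal (by positivity) hmo
    have h2 : ‖d‖ * V ≤ V * A + C.toReal * (2 * A) := by
      have h3 : ‖d‖ ≤ A + V⁻¹ * (C.toReal * (2 * A)) := by
        refine (norm_sub_le _ _).trans (add_le_add hle ?_)
        rw [norm_mul, Complex.norm_real, Real.norm_of_nonneg (by positivity)]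
        gcongr
        exact (norm_integral_le_integral_norm _).trans hfcn
      calc ‖d‖ * V ≤ (A + V⁻¹ * (C.toReal * (2 * A))) * V := by gcongr
        _ = _ := by field_simp
    have h4 : ∫ y, ‖f y‖ ∂μ ≤ C.toReal * (2 * A) + ‖d‖ * V := by
      rw [hfeq]
      calc ∫ y, ‖f₀ y - c + d‖ ∂μ ≤ ∫ y, (‖f₀ y - c‖ + ‖d‖) ∂μ :=
            integral_mono (hfc.add (integrable_const d)).norm
              (hfc.norm.add (integrable_const _)) fun y => norm_add_le _ _
        _ = (∫ y, ‖f₀ y - c‖ ∂μ) + ‖d‖ * V := by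
            rw [integral_add hfc.norm (integrable_const _), integral_const, smul_eq_mul, mul_comm V]
        _ ≤ _ := by gcongr
    rw [bmoNorm]
    linarith
  -- Mean zero makes the added constant invisible. The ball may be of any radius, as `f₀` represents
  -- `l` on all boundedly supported `L^r` functions.
  · intro x ρ a hρ ha
    have hai : Integrable a μ := L1.integrable_coeFn a
    rw [hf₀ a x ρ ha.1 (ha.memLp hpq.pos (hpos x hρ)), hfdef]
    simp only [add_mul]
    rw [integral_add (ha.integrable_mul hpq (hpos x hρ) (hf₀q x ρ)) (hai.const_mul _),
      integral_const_mul, ha.integral_eq_zero, mul_zero, add_zero]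
  · intro a ha
    have hae : a = e := Lp.ext (ha.trans he.symm)
    have hint : ∫ y, f y * e y ∂μ = ((V⁻¹ : ℝ) : ℂ) * ∫ y, f y ∂μ := by
      rw [← integral_const_mul]
      refine integral_congr_ae (he.mono fun y hy => ?_)
      simp only [hy, mul_comm]
      rfl
    have hVV : ((V⁻¹ : ℝ) : ℂ) * (V : ℂ) = 1 := by
      rw [← Complex.ofReal_mul, inv_mul_cancel₀ hV.ne', Complex.ofReal_one]
    rw [hae, hint, hfeq, integral_add hfc (integrable_const d), integral_const, mul_add,
      Complex.real_smul, ← mul_assoc, ← hVdef, hVV, one_mul, hd]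
    ring

omit [BorelSpace M] [IsFiniteMeasure μ] in
theorem memBMO_zero {q : ℝ} (hq : 0 < q) (b : ℝ) :
    MemBMO μ q b 0 ∧ bmoNorm μ q b 0 = 0 := by
  have h : meanOscillation μ q b 0 = 0 := by
    simp [meanOscillation, average_eq, hq]
  exact ⟨⟨integrable_zero _ _ _, by simp [h]⟩, by simp [bmoNorm, h]⟩

end Duality

theorem theoremt {M : Type*} [MetricSpace M] [MeasurableSpace M] [BorelSpace M]
    (μ : Measure M) [IsFiniteMeasure μ] (hμ : μ ≠ 0)
    (hunb : ¬ Bornology.IsBounded (Set.univ : Set M))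
    (hLD : LocallyDoubling μ)
    (R₀ β : ℝ) (hAM : ApproxMidpoint M R₀ β)
    (hCI : ComplIsoperimetric μ)
    (r : ℝ) (hr : 1 < r)
    (b : ℝ) (hb : R₀ / (1 - β) < b) :
    (∀ f : M → ℂ, MemBMO μ r.conjExponent b f →
      ∃ l : StrongDual ℂ (HardySpace μ r b),
        (∀ g : HardySpace μ r b, HardySpace.toL1 μ r b g ∈ finiteAtomic μ r →
          Integrable (fun x => f x * HardySpace.toL1 μ r b g x) μ ∧
          l g = ∫ x, f x * HardySpace.toL1 μ r b g x ∂μ) ∧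
        ‖l‖ ≤ max 1 (μ.real Set.univ)⁻¹ * bmoNorm μ r.conjExponent b f) ∧
    (∃ C : ℝ, ∀ l : StrongDual ℂ (HardySpace μ r b),
      ∃ f : M → ℂ, MemBMO μ r.conjExponent b f ∧
        bmoNorm μ r.conjExponent b f ≤ C * ‖l‖ ∧
        ∀ g : HardySpace μ r b, HardySpace.toL1 μ r b g ∈ finiteAtomic μ r →
          Integrable (fun x => f x * HardySpace.toL1 μ r b g x) μ ∧
          l g = ∫ x, f x * HardySpace.toL1 μ r b g x ∂μ) := by
  have hpq : r.HolderConjugate r.conjExponent := .conjExponent hr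
  -- Since `β > 1 / 2`, `R₀ / (1 - β) ≥ 2 * R₀`.
  have hb2 : 2 * R₀ < b := by
    obtain ⟨h0, h1, h2, -⟩ := hAM
    refine lt_of_le_of_lt ?_ hb
    rw [le_div_iff₀ (by linarith)]
    nlinarith
  have hb0 : 0 < b := by linarith [hAM.1]
  refine ⟨fun f hf => exists_dual_of_memBMO hLD hμ hpq hb0 hf, ?_⟩
  obtain ⟨C, hC⟩ := exists_memBMO_of_atomicBound hLD hμ hAM hCI hpq hb2
  refine ⟨C, fun l => ?_⟩
  -- The zero functional is treated apart because the representation needs a strictly positive bound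
  -- `A`.
  rcases (norm_nonneg l).eq_or_lt with h0 | hpos
  · have hl0 : ∀ g, l g = 0 := fun g => by
      rw [← norm_le_zero_iff]
      simpa [← h0] using l.le_opNorm g
    obtain ⟨h1, h2⟩ := memBMO_zero (μ := μ) hpq.symm.pos b
    refine ⟨0, h1, by rw [h2, ← h0, mul_zero], fun g _ => ?_⟩
    simp [hl0]
  -- A purely algebraic extension from the subspace to `L¹`: its values off the Hardy space are
  -- unconstrained, and the atomic bound is vacuous there.
  · obtain ⟨l', hl'⟩ := LinearMap.exists_extend (p := hardySubmodule μ r b) l.toLinearMap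
    have hll : ∀ g : HardySpace μ r b, l' (HardySpace.toL1 μ r b g) = l g := fun g =>
      LinearMap.congr_fun hl' g
    obtain ⟨f, h1, h2, h3⟩ := hC l' ‖l‖ hpos fun g t ht => by
      have h4 := hll ⟨g, t, ht⟩
      change l' g = _ at h4
      rw [h4]
      refine (l.le_opNorm _).trans ?_
      gcongr
      exact csInf_le (atomicCosts_bddBelow μ r b g) ht
    exact ⟨f, h1, h2, fun g hg => by rw [← hll g]; exact h3 _ hg⟩
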